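/- Let $d,m\in\mathbb N$ with $m\ge 2$, and let $a:[0,\infty)\to\mathbb R$ satisfy $0<a_0\le a(t)\le a_1$ for constants $a_0,a_1$. Let $\Theta,\Xi:[0,\infty)\to(0,\infty)$ be monotone increasing, and let $\Lambda:[0,\infty)\to(0,\infty)$ be continuous and strictly increasing with $\lim_{t\to\infty}\Lambda(t)=\infty$. Assume: * (H1*) there is $a_\infty>0$ with $\int_0^t|a(s)-a_\infty|\,ds\le\Theta(t)$ for all $t\ge0$; * (H2*) $a\in C^m([0,\infty))$ and, for $k=1,\dots,m$, there is $C_k>0$ with $|a^{(k)}(t)|\le C_k\,\Xi(t)^{-k}$ for all $t\ge0$; * $\Theta/\Lambda$ is monotone increasing and $\lim_{t\to\infty}\Theta(t)/\Lambda(t)=\infty$; * (H5*) there is $C_0>0$ with $\Lambda(t)\le C_0\,\Xi(t)$ for all $t\ge0$; * (H6*) $\Xi^{-m}\in L^1([0,\infty))$ and $\sup_{t\ge0}\Lambda(t)^m\,\Theta(t)^{-1}\int_t^\infty\Xi(s)^{-m}\,ds<\infty$. For $u_0,u_1\in\ell^2(\mathbb Z^d)$ (complex valued) let $u\in C^2([0,\infty);\ell^2(\mathbb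 Z^d))$ be a solution of $$u''(t)[k]-a(t)^2\sum_{j=1}^d\big(u(t)[k+e_j]-2u(t)[k]+u(t)[k-e_j]\big)=0,\qquad u(0)=u_0,\quad u'(0)=u_1,$$ with total energy $$E(t)=\sum_{k\in\mathbb Z^d}|u'(t)[k]|^2+a(t)^2\sum_{j=1}^d\sum_{k\in\mathbb Z^d}\big|u(t)[k+e_j]-u(t)[k]\big|^2 .$$ For $f\in\ell^2(\mathbb Z^d)$ let $\hat f(\theta)=\sum_{k\in\mathbb Z^d}e^{-ik\cdot\theta}f[k]$, the series converging in $L^2([-\pi,\pi]^d)$. For $\theta\in[-\pi,\pi]^d$ put $\xi(\theta)=(2\sin\frac{\theta_1}2,\dots,2\sin\frac{\theta_d}2)$, with Euclidean norm $|\xi(\theta)|$. The function $\hat u(t,\cdot)=\widehat{u(t)}$ satisfies $$\partial_t^2\hat u(t,\theta)+a(t)^2|\xi(\theta)|^2\hat u(t,\theta)=0,\qquad(1)$$ and its energy density is $$\mathcal E(t,\theta)=|\partial_t\hat u(t,\theta)|^2+a(t)^2|\xi(\theta)|^2|\hat u(t,\theta)|^2 .$$ For $N>0$ put $$W_N(\theta)=\exp\Big(2|\xi(\theta)|\,\Theta\big(\Lambda^{-1}(N/|\xi(\theta)|)\big)\Big),\qquad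 U(N,u_0,u_1)=\int_{[-\pi,\pi]^d}W_N(\theta)\,\mathcal E(0,\theta)\,d\theta\in[0,\infty].$$ Here $\Lambda^{-1}:[\Lambda(0),\infty)\to[0,\infty)$ is the inverse function of $\Lambda$, extended by $0$ to $(-\infty,\Lambda(0))$, and the exponent is read as $0$ where $\xi(\theta)=0$. Then there are constants $N_0>0$, with $N_0\ge\Lambda(0)|\xi(\theta)|$ for all $\theta\in[-\pi,\pi]^d$, and $C>0$, both independent of $t$, $\theta$ and the initial data, such that $$\mathcal E(t,\theta)\le C\,W_{N_0}(\theta)\,\mathcal E(0,\theta)\qquad(t\ge0).$$ This holds for every $\theta\in[-\pi,\pi]^d$ and every solution of (1) that satisfies (1) pointwise (with $\hat u$ replaced by that solution in $\mathcal E$). It also holds, for each $t\ge0$ and almost every $\theta$, for the Fourier transform $\hat u$ of every solution $u$ as above. Consequently: * (i) if $U(N,u_0,u_1)<\infty$ for every $N\ge1$, then there is $N_1\ge N_0$ with $U(N_1,u_0,u_1)<\infty$ and $E(t)\le C\,U(N_1,u_0,u_1)$ for all $t\ge0$; * (ii) for every $(u_0,u_1)$ with $U(N_0,u_0,u_1)<\infty$,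 one has $E(t)\le C\,U(N_0,u_0,u_1)$ for all $t\ge0$. -/

import Mathlib

open MeasureTheory Set Filter Topology
open scoped ENNReal

noncomputable section

namespace SemiDiscreteWave

/-! ### Lattice sequences -/

/-- The Hilbert space of square summable complex sequences on the lattice `ℤ^d`. -/
abbrev L2Lattice (d : ℕ) : Type := lp (fun _ : Fin d → ℤ => ℂ) 2

/-- Forward difference `(D_j⁺ f)[k] = f[k + e_j] - f[k]`. -/
def fwdDiff {d : ℕ} (j : Fin d) (f : (Fin d → ℤ) → ℂ) (k : Fin d → ℤ) : ℂ :=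
  f (k + Pi.single j 1) - f k

/-- Backward difference `(D_j⁻ f)[k] = f[k] - f[k - e_j]`. -/
def bwdDiff {d : ℕ} (j : Fin d) (f : (Fin d → ℤ) → ℂ) (k : Fin d → ℤ) : ℂ :=
  f k - f (k - Pi.single j 1)

/-- Discrete Laplace operator `∑_j D_j⁺ D_j⁻`. -/
def discreteLaplacian {d : ℕ} (f : (Fin d → ℤ) → ℂ) (k : Fin d → ℤ) : ℂ :=
  ∑ j, fwdDiff j (bwdDiff j f) k

/-- `u` solves `u''(t)[k] - a(t)² ∑_j D_j⁺ D_j⁻ u(t)[k] = 0` on `[0,∞) × ℤ^d` with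
`u(0) = u₀`, `u'(0) = u₁`, as an `ℓ²(ℤ^d)`-valued function; `v` is the time derivative of `u`.
Derivatives are taken in the norm of `ℓ²`, one-sided at `t = 0`. -/
structure IsSolution {d : ℕ} (a : ℝ → ℝ) (u₀ u₁ : L2Lattice d) (u v : ℝ → L2Lattice d) :
    Prop where
  init : u 0 = u₀
  init_deriv : v 0 = u₁
  hasDeriv : ∀ t : ℝ, 0 ≤ t → HasDerivWithinAt u (v t) (Ici 0) t
  equation : ∀ t : ℝ, 0 ≤ t → ∃ w : L2Lattice d, HasDerivWithinAt v w (Ici 0) t ∧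
    ∀ k, w k - ((a t ^ 2 : ℝ) : ℂ) * discreteLaplacian (u t) k = 0

/-- Total energy
`E(t) = ∑_k |u'(t)[k]|² + a(t)² ∑_j ∑_k |D_j⁺ u(t)[k]|²`, as an extended non-negative number. -/
def totalEnergy {d : ℕ} (a : ℝ → ℝ) (u v : ℝ → L2Lattice d) (t : ℝ) : ℝ≥0∞ :=
  (∑' k, ‖v t k‖ₑ ^ 2) +
    ENNReal.ofReal (a t ^ 2) * ∑ j : Fin d, ∑' k, ‖fwdDiff j (u t) k‖ₑ ^ 2

/-! ### Frequency side -/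

/-- The cube `𝕋^d = [-π, π]^d`. -/
def cube (d : ℕ) : Set (Fin d → ℝ) := Set.pi univ fun _ => Icc (-Real.pi) Real.pi

/-- Lebesgue measure on `[-π, π]^d`. -/
abbrev cubeMeasure (d : ℕ) : Measure (Fin d → ℝ) := volume.restrict (cube d)

/-- `θ ↦ e^{-i k·θ}`. -/
def character {d : ℕ} (k : Fin d → ℤ) (θ : Fin d → ℝ) : ℂ :=
  Complex.exp (-(Complex.I * ((∑ j, (k j : ℝ) * θ j : ℝ) : ℂ)))

instance (d : ℕ) : IsFiniteMeasure (cubeMeasure d) :=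
  ⟨by
    rw [Measure.restrict_apply_univ]
    exact (isCompact_univ_pi fun _ => isCompact_Icc).measure_lt_top⟩

theorem norm_character {d : ℕ} (k : Fin d → ℤ) (θ : Fin d → ℝ) : ‖character k θ‖ = 1 := by
  unfold character
  rw [Complex.norm_exp]
  simp

theorem continuous_character {d : ℕ} (k : Fin d → ℤ) : Continuous (character k) := by
  unfold character
  fun_prop

theorem memLp_character {d : ℕ} (k : Fin d → ℤ) : MemLp (character k) 2 (cubeMeasure d) :=
  MemLp.of_bound (continuous_character k).aestronglyMeasurable 1
    (Eventually.of_forall fun θ => (norm_character k θ).le)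

/-- The discrete-time Fourier transform `f̂(θ) = ∑_k e^{-i k·θ} f[k]` of `f ∈ ℓ²(ℤ^d)`,
the series being summed in `L²([-π, π]^d)`. -/
def dtft {d : ℕ} (f : L2Lattice d) : Lp ℂ 2 (cubeMeasure d) :=
  ∑' k, f k • (memLp_character k).toLp (character k)

theorem integral_character {d : ℕ} (n : Fin d → ℤ) :
    ∫ θ, character n θ ∂(cubeMeasure d) = if n = 0 then ((2 * Real.pi) ^ d : ℂ) else 0 := by
  have h1 : ∀ θ : Fin d → ℝ, character n θ =
      ∏ j, Complex.exp (-(Complex.I * (n j : ℂ)) * (θ j : ℂ)) := by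
    intro θ
    rw [← Complex.exp_sum]
    unfold character
    congr 1
    push_cast
    rw [Finset.mul_sum, ← Finset.sum_neg_distrib]
    refine Finset.sum_congr rfl fun j _ => by ring
  have h2 : ∀ k : ℤ, ∫ x in Icc (-Real.pi) Real.pi, Complex.exp (-(Complex.I * (k : ℂ)) * (x : ℂ))
      = if k = 0 then (2 * Real.pi : ℂ) else 0 := by
    intro k
    rw [integral_Icc_eq_integral_Ioc, ← intervalIntegral.integral_of_le (by linarith [Real.pi_pos])]
    split_ifs with hk
    · subst hk; simp; ring
    · have hc : -(Complex.I * (k : ℂ)) ≠ 0 := by simp [hk]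
      rw [integral_exp_mul_complex hc]
      have : Complex.exp (-(Complex.I * k) * ((Real.pi : ℝ) : ℂ)) =
          Complex.exp (-(Complex.I * k) * ((-Real.pi : ℝ) : ℂ)) := by
        rw [Complex.exp_eq_exp_iff_exists_int]
        exact ⟨-k, by push_cast; ring⟩
      rw [this]; simp
  unfold cubeMeasure cube
  rw [volume_pi, Measure.restrict_pi_pi]
  simp_rw [h1]
  rw [integral_fintype_prod_eq_prod (fun j (x : ℝ) => Complex.exp (-(Complex.I * (n j : ℂ)) * (x : ℂ)))]
  simp_rw [h2]
  split_ifs with hn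
  · subst hn; simp
  · obtain ⟨j, hj⟩ := Function.ne_iff.1 hn
    exact Finset.prod_eq_zero (Finset.mem_univ j) (by simpa using hj)

theorem inner_character {d : ℕ} (k l : Fin d → ℤ) :
    inner ℂ ((memLp_character k).toLp (character k)) ((memLp_character l).toLp (character l)) =
      if k = l then ((2 * Real.pi) ^ d : ℂ) else 0 := by
  rw [L2.inner_def]
  have h : ∀ᵐ θ ∂(cubeMeasure d), inner ℂ ((memLp_character k).toLp (character k) θ)
      ((memLp_character l).toLp (character l) θ) = character (l - k) θ := by
    filter_upwards [(memLp_character k).coeFn_toLp, (memLp_character l).coeFn_toLp] with θ h1 h2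
    rw [h1, h2, RCLike.inner_apply]
    unfold character
    rw [← Complex.exp_conj, ← Complex.exp_add]
    congr 1
    simp only [map_neg, map_mul, Complex.conj_I, Complex.conj_ofReal, Pi.sub_apply, Int.cast_sub,
      sub_mul, Finset.sum_sub_distrib, Complex.ofReal_sub]
    ring
  rw [integral_congr_ae h, integral_character]
  simp only [sub_eq_zero, eq_comm]

/-- The series defining `dtft f` converges for every `f ∈ ℓ²(ℤ^d)`. -/
theorem hasSum_dtft {d : ℕ} (f : L2Lattice d) :
    HasSum (fun k => f k • (memLp_character k).toLp (character k)) (dtft f) := by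
  refine Summable.hasSum ?_
  set c : ℝ := (2 * Real.pi) ^ d with hc
  have hcpos : 0 < c := by positivity
  have hs : ((Real.sqrt c : ℝ) : ℂ) * (Real.sqrt c : ℝ) = ((2 * Real.pi) ^ d : ℂ) := by
    rw [← Complex.ofReal_mul, Real.mul_self_sqrt hcpos.le, hc]; push_cast; ring
  have hs0 : ((Real.sqrt c : ℝ) : ℂ) ≠ 0 := by
    simpa using (Real.sqrt_pos.2 hcpos).ne'
  have ho : Orthonormal ℂ (fun k : Fin d → ℤ =>
      ((Real.sqrt c : ℝ) : ℂ)⁻¹ • (memLp_character k).toLp (character k)) := by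
    rw [orthonormal_iff_ite]
    intro k l
    rw [inner_smul_left, inner_smul_right, inner_character, ← hs]
    split_ifs
    · simp only [map_inv₀, Complex.conj_ofReal]; field_simp
    · simp
  have hf := (lp.memℓp f).summable (by norm_num)
  have h := (ho.orthogonalFamily.summable_iff_norm_sq_summable f).2 (by simpa using hf)
  have h' := h.const_smul ((Real.sqrt c : ℝ) : ℂ)
  refine h'.congr fun k => ?_
  simp only [LinearIsometry.toSpanSingleton_apply]
  rw [smul_comm (f k), smul_smul, mul_inv_cancel₀ hs0, one_smul]

/-- `ξ(θ) = (2 sin(θ_1/2), …, 2 sin(θ_d/2))`, a vector of Euclidean space. -/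
def xi {d : ℕ} (θ : Fin d → ℝ) : EuclideanSpace ℝ (Fin d) :=
  WithLp.toLp 2 fun j => 2 * Real.sin (θ j / 2)

/-- `|∂_t û|² + α² |ξ(θ)|² |û|²`. The energy density `ℰ(t, θ)` is its value at `α = a(t)`,
`g = û(t, ·)`, `h = ∂_t û(t, ·)`. -/
def energyDensity {d : ℕ} (α : ℝ) (g h : (Fin d → ℝ) → ℂ) (θ : Fin d → ℝ) : ℝ :=
  ‖h θ‖ ^ 2 + α ^ 2 * ‖xi θ‖ ^ 2 * ‖g θ‖ ^ 2

/-- `w(t, θ)` satisfies `∂_t² w + a(t)² |ξ(θ)|² w = 0` for `t ≥ 0` and every `θ ∈ [-π, π]^d`;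
`z` is the time derivative of `w` (one-sided at `t = 0`). -/
structure IsFrequencySolution {d : ℕ} (a : ℝ → ℝ) (w z : ℝ → (Fin d → ℝ) → ℂ) : Prop where
  hasDeriv : ∀ θ ∈ cube d, ∀ t : ℝ, 0 ≤ t →
    HasDerivWithinAt (fun s => w s θ) (z t θ) (Ici 0) t
  equation : ∀ θ ∈ cube d, ∀ t : ℝ, 0 ≤ t →
    HasDerivWithinAt (fun s => z s θ) (-((a t ^ 2 * ‖xi θ‖ ^ 2 : ℝ) : ℂ) * w t θ) (Ici 0) t

/-! ### Conditions on the propagation speed and on the rate functions -/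

/-- Stabilization: `∫_0^t |a(s) - a_∞| ds ≤ Θ(t)` for some constant `a_∞ > 0`. -/
def StabilizationBound (a Θ : ℝ → ℝ) : Prop :=
  ∃ aInf : ℝ, 0 < aInf ∧ ∀ t : ℝ, 0 ≤ t → (∫ s in (0 : ℝ)..t, |a s - aInf|) ≤ Θ t

/-- `a ∈ C^m([0,∞))` and `|a^{(k)}(t)| ≤ C_k Ξ(t)^{-k}` for `k = 1, …, m`. -/
def DerivativeBounds (m : ℕ) (a Ξ : ℝ → ℝ) : Prop :=
  ContDiffOn ℝ m a (Ici 0) ∧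
    ∀ k : ℕ, 1 ≤ k → k ≤ m → ∃ C : ℝ, 0 < C ∧ ∀ t : ℝ, 0 ≤ t →
      |iteratedDerivWithin k a (Ici 0) t| ≤ C * (Ξ t ^ k)⁻¹

/-- `Θ/Λ` is monotone increasing on `[0,∞)` and tends to infinity. -/
def RatioIncreasesToInfinity (Θ Λ : ℝ → ℝ) : Prop :=
  MonotoneOn (fun t => Θ t / Λ t) (Ici 0) ∧ Tendsto (fun t => Θ t / Λ t) atTop atTop

/-- `Λ(t) ≤ C₀ Ξ(t)` for some constant `C₀ > 0`. -/
def DominatedBy (Λ Ξ : ℝ → ℝ) : Prop :=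
  ∃ C₀ : ℝ, 0 < C₀ ∧ ∀ t : ℝ, 0 ≤ t → Λ t ≤ C₀ * Ξ t

/-- `Ξ^{-m} ∈ L¹([0,∞))` and `sup_{t ≥ 0} Λ(t)^m Θ(t)^{-1} ∫_t^∞ Ξ(s)^{-m} ds < ∞`. -/
def TailBound (m : ℕ) (Θ Ξ Λ : ℝ → ℝ) : Prop :=
  IntegrableOn (fun s => (Ξ s ^ m)⁻¹) (Ici 0) ∧
    ∃ K : ℝ, ∀ t : ℝ, 0 ≤ t → Λ t ^ m * (Θ t)⁻¹ * (∫ s in Ioi t, (Ξ s ^ m)⁻¹) ≤ K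

/-- The inverse `Λ^{-1} : [Λ(0), ∞) → [0, ∞)` of a continuous strictly increasing unbounded
function `Λ` on `[0, ∞)`, extended by `0` below `Λ(0)`. -/
def rateInv (Λ : ℝ → ℝ) (τ : ℝ) : ℝ := sSup {t : ℝ | 0 ≤ t ∧ Λ t ≤ τ}

theorem rateInv_apply {Λ : ℝ → ℝ} (hΛ : StrictMonoOn Λ (Ici 0)) {t : ℝ} (ht : 0 ≤ t) :
    rateInv Λ (Λ t) = t := by
  have h : {s : ℝ | 0 ≤ s ∧ Λ s ≤ Λ t} = Icc 0 t := by
    ext s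
    exact ⟨fun hs => ⟨hs.1, (hΛ.le_iff_le hs.1 ht).1 hs.2⟩,
      fun hs => ⟨hs.1, (hΛ.le_iff_le hs.1 ht).2 hs.2⟩⟩
  rw [rateInv, h, csSup_Icc ht]

theorem rateInv_of_lt {Λ : ℝ → ℝ} (hΛ : StrictMonoOn Λ (Ici 0)) {τ : ℝ} (hτ : τ < Λ 0) :
    rateInv Λ τ = 0 := by
  have h : {s : ℝ | 0 ≤ s ∧ Λ s ≤ τ} = ∅ := by
    ext s
    simp only [mem_ofPred_eq, mem_empty_iff_false, iff_false, not_and, not_le]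
    exact fun hs => hτ.trans_le (hΛ.monotoneOn self_mem_Ici hs hs)
  rw [rateInv, h, Real.sSup_empty]

/-- `exp(2 |ξ(θ)| Θ(Λ^{-1}(N / |ξ(θ)|)))`; at `ξ(θ) = 0` the exponent is `0`. -/
def weight {d : ℕ} (Θ Λ : ℝ → ℝ) (N : ℝ) (θ : Fin d → ℝ) : ℝ :=
  Real.exp (2 * ‖xi θ‖ * Θ (rateInv Λ (N / ‖xi θ‖)))

/-- `U(N, u₀, u₁) = ∫_{[-π, π]^d} exp(2 |ξ| Θ(Λ^{-1}(N / |ξ|))) ℰ(0, θ) dθ`,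
as an extended non-negative number. -/
def weightedEnergy {d : ℕ} (a Θ Λ : ℝ → ℝ) (N : ℝ) (u₀ u₁ : L2Lattice d) : ℝ≥0∞ :=
  ∫⁻ θ in cube d,
    ENNReal.ofReal (weight Θ Λ N θ * energyDensity (a 0) (dtft u₀) (dtft u₁) θ)

end SemiDiscreteWave

end

noncomputable section

namespace SemiDiscreteWave

open scoped BoundedContinuousFunction

/-! ### Gronwall's inequality with an integrable rate -/

/-! At a fixed frequency the equation is `x'' + (a r)² x = 0` with `r = |ξ(θ)|`, so everything rests
on an energy estimate for this oscillator whose constants do not depend on `r`. Time is split at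
`τ`, where `r Λ(τ) = N`.

Before `τ` the speed is compared with the constant `a_∞`. The logarithm of the energy for constant
speed grows at a rate at most a constant times `r |a - a_∞|`, and stabilization bounds the integral
by `M₁ r Θ(τ)` (`exists_energy_le_of_stabilization`).

After `τ` one has `r Ξ ≥ N / C₀`, and negative powers of `r Ξ` serve as a calculus of small symbols.
Correcting `σ = i a` successively gives an approximate solution of the Riccati equation `r⁻¹ σ' + σ²
+ a² = ρ` with `ρ = O((r Ξ)^{-m})` (`exists_riccati_approximation`). For an exact solution, `|x' - r
σ x|² / (r Im σ)` is conserved; in general its logarithmic growth is of size `∫ r |ρ|`. The tail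
condition bounds this by a constant times `r Θ(τ) (r Λ(τ))^{-m}`, hence by `M₂ r Θ(τ)`
(`exists_energy_le_of_symbol`).

To turn `M₁ + M₂` into the factor `2` of the weight, `N` is enlarged to `κ N`: if `Λ(T) = κ Λ(τ)`
with `κ ≥ 1`, monotonicity of `Θ/Λ` gives `κ Θ(τ) ≤ Θ(T)` (`exists_energy_le`).

The lattice statements follow by Fourier transform and Parseval. Since `û(t)` is only an `L²` class
for each `t`, it must be identified almost everywhere with a pointwise solution;
`IsSolution.exists_isFrequencySolution` builds one from bounded continuous fundamental solutions and
uses uniqueness in `L²`. -/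

theorem gronwall_integral {F F' k : ℝ → ℝ} {s t : ℝ} (hs : 0 ≤ s) (hst : s ≤ t)
    (hk : ContinuousOn k (Ici 0))
    (hF : ∀ x ∈ Icc s t, HasDerivWithinAt F (F' x) (Ici 0) x)
    (hle : ∀ x ∈ Icc s t, F' x ≤ k x * F x) :
    F t ≤ F s * Real.exp (∫ x in s..t, k x) := by
  -- Freezing `k` at its value at `0` on the negative axis makes it continuous on the whole line, so
  -- its primitive is differentiable also at the endpoint.
  set K : ℝ → ℝ := fun x => k (max x 0) with hK
  have hKc : Continuous K :=
    hk.comp_continuous (by fun_prop) fun x => mem_Ici.2 (le_max_right _ _)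
  have hKk : ∀ x : ℝ, 0 ≤ x → K x = k x := fun x hx => by simp [hK, max_eq_left hx]
  set J : ℝ → ℝ := fun y => ∫ x in s..y, K x with hJ
  have hJd : ∀ y, HasDerivAt J (K y) y := fun y =>
    (hKc.integral_hasStrictDerivAt s y).hasDerivAt
  have hG : ∀ x ∈ Icc s t, HasDerivWithinAt (fun x => F x * Real.exp (-J x))
      ((F' x - k x * F x) * Real.exp (-J x)) (Ici 0) x := by
    intro x hx
    have h := (hF x hx).mul ((hJd x).neg.exp.hasDerivWithinAt (s := Ici 0))
    refine h.congr_deriv ?_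
    rw [← hKk x (hs.trans hx.1)]; simp only [Pi.neg_apply]; ring
  have hanti : AntitoneOn (fun x => F x * Real.exp (-J x)) (Icc s t) := by
    refine antitoneOn_of_hasDerivWithinAt_nonpos
      (f' := fun x => (F' x - k x * F x) * Real.exp (-J x)) (convex_Icc s t) ?_ ?_ ?_
    · intro x hx
      exact ((hG x hx).continuousWithinAt).mono fun y hy => hs.trans hy.1
    · intro x hx
      have hx' := interior_subset hx
      exact (hG x hx').mono fun y hy => hs.trans (interior_subset hy).1
    · intro x hx
      exact mul_nonpos_of_nonpos_of_nonneg (by linarith [hle x (interior_subset hx)])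
        (Real.exp_pos _).le
  have h := hanti (left_mem_Icc.2 hst) (right_mem_Icc.2 hst) hst
  have hJs : J s = 0 := by simp [hJ]
  have hJt : J t = ∫ x in s..t, k x := by
    refine intervalIntegral.integral_congr fun x hx => hKk x ?_
    rw [uIcc_of_le hst] at hx
    exact hs.trans hx.1
  simp only [hJs, neg_zero, Real.exp_zero, mul_one] at h
  rw [← hJt]
  calc F t = F t * Real.exp (-J t) * Real.exp (J t) := by
        rw [mul_assoc, ← Real.exp_add]; simp
    _ ≤ _ := by gcongr

/-! ### Energy estimates for the scalar oscillator -/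

/-- `x'' + b² x = 0` on `[0, ∞)`, with `y = x'`. -/
structure IsOscillation (b x y : ℝ → ℝ) : Prop where
  hasDeriv : ∀ t : ℝ, 0 ≤ t → HasDerivWithinAt x (y t) (Ici 0) t
  equation : ∀ t : ℝ, 0 ≤ t → HasDerivWithinAt y (-(b t ^ 2 * x t)) (Ici 0) t

/-- Comparison with a constant frequency `β`. -/
theorem IsOscillation.energy_le_of_constant {b x y k : ℝ → ℝ} {β t : ℝ} (h : IsOscillation b x y)
    (hβ : 0 < β) (ht : 0 ≤ t) (hk : ContinuousOn k (Ici 0))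
    (hle : ∀ s : ℝ, 0 ≤ s → |b s ^ 2 - β ^ 2| / β ≤ k s) :
    y t ^ 2 + β ^ 2 * x t ^ 2 ≤
      (y 0 ^ 2 + β ^ 2 * x 0 ^ 2) * Real.exp (∫ s in (0 : ℝ)..t, k s) := by
  refine gronwall_integral (F := fun t => y t ^ 2 + β ^ 2 * x t ^ 2)
    (F' := fun s => 2 * (β ^ 2 - b s ^ 2) * (x s * y s)) le_rfl ht hk ?_ ?_
  · intro s hs
    have h1 := ((h.equation s hs.1).pow 2).add (((h.hasDeriv s hs.1).pow 2).const_mul (β ^ 2))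
    refine h1.congr_deriv ?_
    simp; ring
  · intro s hs
    have hE : 2 * (β * |x s|) * |y s| ≤ y s ^ 2 + β ^ 2 * x s ^ 2 := by
      have := two_mul_le_add_sq (β * |x s|) |y s|
      rw [mul_pow, sq_abs, sq_abs] at this; linarith
    have h0 : 0 ≤ y s ^ 2 + β ^ 2 * x s ^ 2 := by positivity
    calc 2 * (β ^ 2 - b s ^ 2) * (x s * y s)
        ≤ |2 * (β ^ 2 - b s ^ 2) * (x s * y s)| := le_abs_self _
      _ = |b s ^ 2 - β ^ 2| / β * (2 * (β * |x s|) * |y s|) := by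
          rw [abs_mul, abs_mul, abs_mul, abs_sub_comm, abs_two]; field_simp
      _ ≤ |b s ^ 2 - β ^ 2| / β * (y s ^ 2 + β ^ 2 * x s ^ 2) := by gcongr
      _ ≤ _ := by gcongr; exact hle s hs.1

/-- Comparison along an approximate solution `p + i q` of the Riccati equation of `x'' + b² x = 0`,
with remainder `ρ₁ + i ρ₂`. -/
theorem IsOscillation.energy_le_of_riccati {b x y p q ρ₁ ρ₂ k : ℝ → ℝ} {s t : ℝ}
    (h : IsOscillation b x y) (hs : 0 ≤ s) (hst : s ≤ t)
    (hp : ∀ τ : ℝ, 0 ≤ τ →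
      HasDerivWithinAt p (ρ₁ τ - p τ ^ 2 + q τ ^ 2 - b τ ^ 2) (Ici 0) τ)
    (hq : ∀ τ : ℝ, 0 ≤ τ → HasDerivWithinAt q (ρ₂ τ - 2 * p τ * q τ) (Ici 0) τ)
    (hq0 : ∀ τ ∈ Icc s t, 0 < q τ) (hk : ContinuousOn k (Ici 0))
    (hle : ∀ τ ∈ Icc s t, (|ρ₁ τ| + 3 * |ρ₂ τ|) / q τ ≤ k τ) :
    ((y t - p t * x t) ^ 2 + q t ^ 2 * x t ^ 2) / q t ≤
      ((y s - p s * x s) ^ 2 + q s ^ 2 * x s ^ 2) / q s *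
        Real.exp (∫ τ in s..t, k τ) := by
  -- With `σ = p + i q`, `F = |y - σ x|² / q`. If `σ` solved the Riccati equation exactly, numerator
  -- and denominator would both have logarithmic derivative `-2 p`, so `F` would be constant. The
  -- remainder contributes three error terms, which account for `|ρ₁| + 3 |ρ₂|`.
  set F : ℝ → ℝ := fun τ => ((y τ - p τ * x τ) ^ 2 + q τ ^ 2 * x τ ^ 2) / q τ with hF
  refine gronwall_integral (F := F)
    (F' := fun τ => -2 * ρ₁ τ * (x τ * (y τ - p τ * x τ)) / q τ + 2 * ρ₂ τ * x τ ^ 2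
      - ρ₂ τ / q τ * F τ) hs hst hk ?_ ?_
  · intro τ hτ
    have hτ0 := hs.trans hτ.1
    have hx := h.hasDeriv τ hτ0
    have hy := h.equation τ hτ0
    have hq' := (hq0 τ hτ).ne'
    have h1 := ((((hy.sub ((hp τ hτ0).mul hx)).pow 2).add
      (((hq τ hτ0).pow 2).mul (hx.pow 2))).div (hq τ hτ0) hq')
    refine h1.congr_deriv ?_
    simp [hF]
    field_simp
    ring
  · intro τ hτ
    have hq' := hq0 τ hτ
    have hF0 : 0 ≤ F τ := by positivity
    refine le_trans ?_ (mul_le_mul_of_nonneg_right (hle τ hτ) hF0)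
    set Y := y τ - p τ * x τ with hY
    have hFq : F τ * q τ = Y ^ 2 + q τ ^ 2 * x τ ^ 2 := by
      simp only [hF, hY]; field_simp
    have h1 : -2 * ρ₁ τ * (x τ * Y) / q τ ≤ |ρ₁ τ| / q τ * F τ := by
      have h2 : 2 * (q τ * |x τ|) * |Y| ≤ F τ * q τ := by
        have := two_mul_le_add_sq (q τ * |x τ|) |Y|
        rw [mul_pow, sq_abs, sq_abs] at this; linarith
      have h3 : 2 * |x τ| * |Y| ≤ F τ := by
        refine le_of_mul_le_mul_right ?_ hq'; linarith
      have h4 : -2 * ρ₁ τ * (x τ * Y) ≤ |ρ₁ τ| * F τ := by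
        calc -2 * ρ₁ τ * (x τ * Y) ≤ |-2 * ρ₁ τ * (x τ * Y)| := le_abs_self _
          _ = |ρ₁ τ| * (2 * |x τ| * |Y|) := by
            rw [abs_mul, abs_mul, abs_mul, abs_neg, abs_two]; ring
          _ ≤ _ := by gcongr
      rw [div_mul_eq_mul_div]
      gcongr
    have h5 : 2 * ρ₂ τ * x τ ^ 2 ≤ 2 * |ρ₂ τ| / q τ * F τ := by
      have h6 : q τ * x τ ^ 2 ≤ F τ := by
        refine le_of_mul_le_mul_right ?_ hq'
        rw [hFq]; nlinarith [sq_nonneg Y]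
      calc 2 * ρ₂ τ * x τ ^ 2 ≤ 2 * |ρ₂ τ| * x τ ^ 2 := by
            gcongr; exact le_abs_self _
        _ = 2 * |ρ₂ τ| / q τ * (q τ * x τ ^ 2) := by field_simp
        _ ≤ _ := by gcongr
    have h7 : -(ρ₂ τ / q τ * F τ) ≤ |ρ₂ τ| / q τ * F τ := by
      rw [← neg_mul, ← neg_div]
      gcongr; exact neg_le_abs _
    have h8 : (|ρ₁ τ| + 3 * |ρ₂ τ|) / q τ * F τ =
        |ρ₁ τ| / q τ * F τ + 2 * |ρ₂ τ| / q τ * F τ + |ρ₂ τ| / q τ * F τ := by ring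
    rw [h8]
    linarith

/-! ### Symbols -/

/-- `|f(r, t)| ≤ C (r Ξ(t))^{-j}` in the zone `r Ξ(t) ≥ 1`. -/
def SymbolBound (Ξ : ℝ → ℝ) (j : ℕ) (f : ℝ → ℝ → ℂ) : Prop :=
  ∃ C : ℝ, 0 ≤ C ∧ ∀ r t : ℝ, 0 < r → 0 ≤ t → 1 ≤ r * Ξ t → ‖f r t‖ ≤ C * ((r * Ξ t) ^ j)⁻¹

/-- Symbols of order `-j` with `n` derivatives in `t`, each application of `r⁻¹ ∂_t` lowering the
order by one. -/
def IsSymbol (Ξ : ℝ → ℝ) : ℕ → ℕ → (ℝ → ℝ → ℂ) → Prop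
  | 0, j, f => SymbolBound Ξ j f ∧ ∀ r : ℝ, 0 < r → ContinuousOn (f r) (Ici 0)
  | n + 1, j, f => SymbolBound Ξ j f ∧ ∃ g : ℝ → ℝ → ℂ, IsSymbol Ξ n (j + 1) g ∧
      ∀ r t : ℝ, 0 < r → 0 ≤ t → HasDerivWithinAt (f r) (r * g r t) (Ici 0) t

variable {Ξ : ℝ → ℝ} {n i j : ℕ} {f g : ℝ → ℝ → ℂ}

/-- The bound is only asked for where `r Ξ ≥ 1`, and there higher negative powers are smaller. -/
theorem SymbolBound.mono (h : SymbolBound Ξ j f) (hij : i ≤ j) : SymbolBound Ξ i f := by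
  obtain ⟨C, hC, h⟩ := h
  refine ⟨C, hC, fun r t hr ht h1 => (h r t hr ht h1).trans ?_⟩
  have : 0 < r * Ξ t := by linarith
  gcongr

theorem SymbolBound.add (hf : SymbolBound Ξ j f) (hg : SymbolBound Ξ j g) :
    SymbolBound Ξ j (fun r t => f r t + g r t) := by
  obtain ⟨C, hC, hf⟩ := hf
  obtain ⟨D, hD, hg⟩ := hg
  refine ⟨C + D, by positivity, fun r t hr ht h1 => (norm_add_le _ _).trans ?_⟩
  rw [add_mul]
  exact add_le_add (hf r t hr ht h1) (hg r t hr ht h1)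

theorem SymbolBound.mul (hf : SymbolBound Ξ i f) (hg : SymbolBound Ξ j g) :
    SymbolBound Ξ (i + j) (fun r t => f r t * g r t) := by
  obtain ⟨C, hC, hf⟩ := hf
  obtain ⟨D, hD, hg⟩ := hg
  refine ⟨C * D, by positivity, fun r t hr ht h1 => ?_⟩
  have h0 : 0 < r * Ξ t := by linarith
  rw [norm_mul, pow_add, mul_inv, mul_mul_mul_comm]
  exact mul_le_mul (hf r t hr ht h1) (hg r t hr ht h1) (norm_nonneg _) (by positivity)

theorem IsSymbol.bound (h : IsSymbol Ξ n j f) : SymbolBound Ξ j f := by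
  cases n <;> exact h.1

theorem IsSymbol.continuousOn (h : IsSymbol Ξ n j f) (r : ℝ) (hr : 0 < r) :
    ContinuousOn (f r) (Ici 0) := by
  cases n with
  | zero => exact h.2 r hr
  | succ n =>
    obtain ⟨-, g, -, hg⟩ := h
    exact fun t ht => (hg r t hr ht).continuousWithinAt

theorem IsSymbol.order_mono (h : IsSymbol Ξ n j f) (hij : i ≤ j) : IsSymbol Ξ n i f := by
  induction n generalizing i j f with
  | zero => exact ⟨h.1.mono hij, h.2⟩
  | succ n ih =>
    obtain ⟨hb, g, hg, hd⟩ := h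
    exact ⟨hb.mono hij, g, ih hg (by omega), hd⟩

theorem IsSymbol.of_succ (h : IsSymbol Ξ (n + 1) j f) : IsSymbol Ξ n j f := by
  induction n generalizing j f with
  | zero => exact ⟨h.bound, h.continuousOn⟩
  | succ n ih =>
    obtain ⟨hb, g, hg, hd⟩ := h
    exact ⟨hb, g, ih hg, hd⟩

theorem IsSymbol.add (hf : IsSymbol Ξ n j f) (hg : IsSymbol Ξ n j g) :
    IsSymbol Ξ n j (fun r t => f r t + g r t) := by
  induction n generalizing j f g with
  | zero => exact ⟨hf.1.add hg.1, fun r hr => (hf.2 r hr).add (hg.2 r hr)⟩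
  | succ n ih =>
    obtain ⟨hb, f', hf', hd⟩ := hf
    obtain ⟨hb₂, g', hg', hd₂⟩ := hg
    refine ⟨hb.add hb₂, _, ih hf' hg', fun r t hr ht => ?_⟩
    exact ((hd r t hr ht).add (hd₂ r t hr ht)).congr_deriv (by ring)

theorem IsSymbol.mul (hf : IsSymbol Ξ n i f) (hg : IsSymbol Ξ n j g) :
    IsSymbol Ξ n (i + j) (fun r t => f r t * g r t) := by
  induction n generalizing i j f g with
  | zero => exact ⟨hf.1.mul hg.1, fun r hr => (hf.2 r hr).mul (hg.2 r hr)⟩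
  | succ n ih =>
    have hf₀ := hf.of_succ
    have hg₀ := hg.of_succ
    obtain ⟨hb, f', hf', hd⟩ := hf
    obtain ⟨hb₂, g', hg', hd₂⟩ := hg
    have h1 := ih hf' hg₀
    have h2 := ih hf₀ hg'
    rw [show i + 1 + j = i + j + 1 by ring] at h1
    refine ⟨hb.mul hb₂, _, h1.add h2, fun r t hr ht => ?_⟩
    exact ((hd r t hr ht).mul (hd₂ r t hr ht)).congr_deriv (by ring)

theorem IsSymbol.zero : IsSymbol Ξ n j (fun _ _ => 0) := by
  induction n generalizing j with
  | zero => exact ⟨⟨0, le_rfl, by simp⟩, fun r hr => continuousOn_const⟩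
  | succ n ih =>
    exact ⟨⟨0, le_rfl, by simp⟩, _, ih, fun r t hr ht => by
      simpa using hasDerivWithinAt_const t (Ici (0 : ℝ)) (0 : ℂ)⟩

theorem IsSymbol.const (c : ℂ) : IsSymbol Ξ n 0 (fun _ _ => c) := by
  have hb : SymbolBound Ξ 0 (fun _ _ => c) := ⟨‖c‖, norm_nonneg c, by simp⟩
  cases n with
  | zero => exact ⟨hb, fun r hr => continuousOn_const⟩
  | succ n => exact ⟨hb, _, IsSymbol.zero, fun r t hr ht => by
      simpa using hasDerivWithinAt_const t (Ici (0 : ℝ)) c⟩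

/-- The scaled derivative of `1/f` is `-f⁻² g`, a product covered by induction on the number of
derivatives. The lower bound is needed outside the zone too, because regularity in `t` is required
for all `r > 0`. -/
theorem IsSymbol.inv {c : ℝ} (hc : 0 < c) (hf : IsSymbol Ξ n 0 f)
    (hfc : ∀ r t : ℝ, 0 < r → 0 ≤ t → c ≤ ‖f r t‖) : IsSymbol Ξ n 0 (fun r t => (f r t)⁻¹) := by
  have hb : SymbolBound Ξ 0 (fun r t => (f r t)⁻¹) := by
    refine ⟨c⁻¹, by positivity, fun r t hr ht _ => ?_⟩
    rw [norm_inv, pow_zero, inv_one, mul_one]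
    exact inv_anti₀ hc (hfc r t hr ht)
  have h0 : ∀ r t : ℝ, 0 < r → 0 ≤ t → f r t ≠ 0 := fun r t hr ht =>
    norm_pos_iff.1 (hc.trans_le (hfc r t hr ht))
  induction n with
  | zero => exact ⟨hb, fun r hr => (hf.2 r hr).inv₀ fun t ht => h0 r t hr ht⟩
  | succ n ih =>
    have hi := ih hf.of_succ
    obtain ⟨-, g, hg, hd⟩ := hf
    have h1 := (((IsSymbol.const (Ξ := Ξ) (n := n) (-1)).mul hi).mul hi).mul hg
    simp only [zero_add] at h1
    refine ⟨hb, _, h1, fun r t hr ht => ?_⟩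
    refine ((hd r t hr ht).inv (h0 r t hr ht)).congr_deriv ?_
    have := h0 r t hr ht
    field_simp

/-- A function with symbol-like derivative bounds is a symbol of order `0`. -/
theorem DerivativeBounds.isSymbol {m : ℕ} {a : ℝ → ℝ} {a₁ : ℝ} (h : DerivativeBounds m a Ξ)
    (ha : ∀ t : ℝ, 0 ≤ t → |a t| ≤ a₁) : IsSymbol Ξ m 0 (fun _ t => (a t : ℂ)) := by
  have hbd : ∀ k ≤ m, ∃ C : ℝ, 0 ≤ C ∧ ∀ t : ℝ, 0 ≤ t →
      |iteratedDerivWithin k a (Ici 0) t| ≤ C * (Ξ t ^ k)⁻¹ := by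
    intro k hk
    rcases Nat.eq_zero_or_pos k with rfl | hk0
    · refine ⟨a₁, (abs_nonneg _).trans (ha 0 le_rfl), fun t ht => ?_⟩
      simpa using ha t ht
    · obtain ⟨C, hC, h⟩ := h.2 k hk0 hk
      exact ⟨C, hC.le, h⟩
  have hU : UniqueDiffOn ℝ (Ici (0 : ℝ)) := uniqueDiffOn_Ici 0
  have hsb : ∀ k ≤ m, SymbolBound Ξ k
      (fun r t => ((iteratedDerivWithin k a (Ici 0) t / r ^ k : ℝ) : ℂ)) := by
    intro k hk
    obtain ⟨C, hC, h⟩ := hbd k hk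
    refine ⟨C, hC, fun r t hr ht _ => ?_⟩
    rw [Complex.norm_real, Real.norm_eq_abs, abs_div, abs_of_pos (pow_pos hr k), mul_pow, mul_inv,
      div_eq_inv_mul, mul_left_comm]
    gcongr
    exact h t ht
  -- With `a^{(k)} / r^k` of order `-k`, there remain `n = m - k` derivatives; the induction starts
  -- at `k = m`, where only continuity is left.
  have key : ∀ n k, n + k = m → IsSymbol Ξ n k
      (fun r t => ((iteratedDerivWithin k a (Ici 0) t / r ^ k : ℝ) : ℂ)) := by
    intro n
    induction n with
    | zero =>
      intro k hk
      refine ⟨hsb k (by omega), fun r hr => ?_⟩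
      refine Complex.continuous_ofReal.comp_continuousOn (ContinuousOn.div_const ?_ _)
      exact h.1.continuousOn_iteratedDerivWithin (by exact_mod_cast (by omega : k ≤ m)) hU
    | succ n ih =>
      intro k hk
      refine ⟨hsb k (by omega), _, ih (k + 1) (by omega), fun r t hr ht => ?_⟩
      have h1 := (h.1.differentiableOn_iteratedDerivWithin
        (by exact_mod_cast (by omega : k < m)) hU t ht).hasDerivWithinAt
      rw [← iteratedDerivWithin_succ] at h1
      refine (h1.div_const (r ^ k)).ofReal_comp.congr_deriv ?_
      have : (r : ℂ) ≠ 0 := by exact_mod_cast hr.ne'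
      push_cast
      field_simp
      ring
  simpa using key m 0 rfl

/-- Approximate solutions `σ = i a + ε` of the Riccati equation `r⁻¹ σ' + σ² + a² = ρ`, obtained by
iterating `σ ↦ σ - ρ / (2 i a)`. -/
theorem exists_riccati_approximation {m : ℕ} {a : ℝ → ℝ} {a₀ : ℝ} (ha₀ : 0 < a₀)
    (ha : ∀ t : ℝ, 0 ≤ t → a₀ ≤ a t) (h : IsSymbol Ξ m 0 (fun _ t => (a t : ℂ)))
    {n : ℕ} (hn : n + 1 ≤ m) :
    ∃ ε ρ : ℝ → ℝ → ℂ, IsSymbol Ξ (m - n) 1 ε ∧ IsSymbol Ξ (m - 1 - n) (n + 1) ρ ∧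
      ∀ r t : ℝ, 0 < r → 0 ≤ t → HasDerivWithinAt (fun s => Complex.I * a s + ε r s)
        (r * (ρ r t - (Complex.I * a t + ε r t) ^ 2 - a t ^ 2)) (Ici 0) t := by
  have hinv : IsSymbol Ξ m 0 (fun _ t => (a t : ℂ)⁻¹) := by
    refine h.inv ha₀ fun r t hr ht => ?_
    rw [Complex.norm_real, Real.norm_eq_abs]
    exact (ha t ht).trans (le_abs_self _)
  have hmono : ∀ {k l j : ℕ} {f : ℝ → ℝ → ℂ}, IsSymbol Ξ l j f → k ≤ l → IsSymbol Ξ k j f := by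
    intro k l j f hf hkl
    induction hkl with
    | refl => exact hf
    | step _ ih => exact ih hf.of_succ
  induction n with
  | zero =>
    obtain ⟨m, rfl⟩ : ∃ l, m = l + 1 := ⟨m - 1, by omega⟩
    obtain ⟨-, g, hg, hd⟩ := h
    refine ⟨fun _ _ => 0, fun r t => Complex.I * g r t, IsSymbol.zero, ?_, fun r t hr ht => ?_⟩
    · simpa using (IsSymbol.const Complex.I).mul hg
    · have := (hd r t hr ht).const_mul Complex.I
      simp only [add_zero]
      refine this.congr_deriv ?_
      rw [mul_pow, Complex.I_sq]; ring
  | succ n ih =>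
    -- The correction `δ = iρ/(2a)` satisfies `2 i a δ = -ρ` and cancels the old remainder. What is
    -- left is `r⁻¹ δ' + 2 ε δ + δ²`, one order better because `ε` has order `-1`; the price is one
    -- derivative.
    obtain ⟨ε, ρ, hε, hρ, hd⟩ := ih (by omega)
    have hδ : IsSymbol Ξ (m - 1 - n) (n + 1) (fun r t => Complex.I / 2 * ((a t : ℂ)⁻¹ * ρ r t)) := by
      have := (IsSymbol.const (Complex.I / 2)).mul ((hmono hinv (by omega)).mul hρ)
      simpa using this
    set δ : ℝ → ℝ → ℂ := fun r t => Complex.I / 2 * ((a t : ℂ)⁻¹ * ρ r t) with hδdef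
    have e1 : m - 1 - n = (m - 1 - (n + 1)) + 1 := by omega
    have hδ' := hδ
    rw [e1] at hδ'
    obtain ⟨-, g, hg, hgd⟩ := hδ'
    have hε' : IsSymbol Ξ (m - (n + 1)) 1 ε := hmono hε (by omega)
    have hδ₁ : IsSymbol Ξ (m - (n + 1)) (n + 1) δ := hmono hδ (by omega)
    refine ⟨fun r t => ε r t + δ r t,
      fun r t => g r t + (2 * (ε r t * δ r t) + δ r t * δ r t), hε'.add (hδ₁.order_mono (by omega)),
      ?_, fun r t hr ht => ?_⟩
    · have hε₂ : IsSymbol Ξ (m - 1 - (n + 1)) 1 ε := hmono hε (by omega)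
      have hδ₂ : IsSymbol Ξ (m - 1 - (n + 1)) (n + 1) δ := hmono hδ (by omega)
      refine hg.add (IsSymbol.add ?_ ?_)
      · have := (IsSymbol.const (Ξ := Ξ) (n := m - 1 - (n + 1)) 2).mul (hε₂.mul hδ₂)
        exact this.order_mono (by omega)
      · exact (hδ₂.mul hδ₂).order_mono (by omega)
    · have h1 := (hd r t hr ht).add (hgd r t hr ht)
      have ha' : (a t : ℂ) ≠ 0 := by exact_mod_cast (ha₀.trans_le (ha t ht)).ne'
      have h2 : 2 * (Complex.I * a t) * δ r t = -ρ r t := by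
        simp only [hδdef]
        field_simp
        rw [Complex.I_sq, neg_one_mul]
      refine (h1.congr_of_eventuallyEq (Eventually.of_forall fun s => ?_) ?_).congr_deriv ?_
      · simp [add_assoc]
      · simp [add_assoc]
      · linear_combination r * h2

/-! ### Energy estimates uniform in the frequency -/

/-- For `σ = P + i Q` close to `i a`, the Riccati functional times `r` is equivalent to the energy.
The factor `r` offsets the division by `r Q`, so the constants depend on `a₀` and `a₁` only. -/
theorem energy_le_riccati_functional {a₀ a₁ α r P Q x y : ℝ} (ha₀ : 0 < a₀) (hr : 0 < r)
    (hα : a₀ ≤ α) (hα₁ : α ≤ a₁) (hP : |P| ≤ a₀ / 2) (hQ : a₀ / 2 ≤ Q) (hQ₁ : Q ≤ 3 * a₁ / 2) :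
    y ^ 2 + (α * r) ^ 2 * x ^ 2 ≤ (2 + 4 * a₁ ^ 2 / a₀ ^ 2) * (3 * a₁ / 2) *
      (r * (((y - r * P * x) ^ 2 + (r * Q) ^ 2 * x ^ 2) / (r * Q))) := by
  have hQ0 : 0 < Q := by linarith
  have hα0 : 0 < α := by linarith
  set G := (y - r * P * x) ^ 2 + (r * Q) ^ 2 * x ^ 2 with hG
  have hP2 : P ^ 2 ≤ Q ^ 2 := by
    rw [← sq_abs P]; exact pow_le_pow_left₀ (abs_nonneg _) (hP.trans hQ) 2
  have h1 : y ^ 2 ≤ 2 * G := by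
    have h2 : (r * P * x) ^ 2 ≤ (r * Q) ^ 2 * x ^ 2 := by
      rw [mul_pow, mul_pow, mul_pow]; gcongr
    nlinarith [sq_nonneg (y - 2 * (r * P * x))]
  have h2 : (α * r) ^ 2 * x ^ 2 ≤ 4 * a₁ ^ 2 / a₀ ^ 2 * G := by
    have h3 : (α * r) ^ 2 * x ^ 2 ≤ 4 * a₁ ^ 2 / a₀ ^ 2 * ((r * Q) ^ 2 * x ^ 2) := by
      calc (α * r) ^ 2 * x ^ 2 ≤ (a₁ * r) ^ 2 * x ^ 2 := by gcongr
        _ = 4 * a₁ ^ 2 / a₀ ^ 2 * ((r * (a₀ / 2)) ^ 2 * x ^ 2) := by field_simp; ring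
        _ ≤ _ := by gcongr
    refine h3.trans ?_
    gcongr
    nlinarith [sq_nonneg (y - r * P * x)]
  have h4 : r * (G / (r * Q)) = G / Q := by field_simp
  have hG0 : 0 ≤ G := by positivity
  rw [h4]
  calc y ^ 2 + (α * r) ^ 2 * x ^ 2 ≤ (2 + 4 * a₁ ^ 2 / a₀ ^ 2) * G := by linarith
    _ = (2 + 4 * a₁ ^ 2 / a₀ ^ 2) * Q * (G / Q) := by field_simp
    _ ≤ _ := by gcongr

theorem riccati_functional_le_energy {a₀ a₁ α r P Q x y : ℝ} (ha₀ : 0 < a₀) (hr : 0 < r)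
    (hα : a₀ ≤ α) (hα₁ : α ≤ a₁) (hP : |P| ≤ a₀ / 2) (hQ : a₀ / 2 ≤ Q) (hQ₁ : Q ≤ 3 * a₁ / 2) :
    r * (((y - r * P * x) ^ 2 + (r * Q) ^ 2 * x ^ 2) / (r * Q)) ≤
      2 / a₀ * (2 + 3 * a₁ ^ 2 / a₀ ^ 2) * (y ^ 2 + (α * r) ^ 2 * x ^ 2) := by
  have hQ0 : 0 < Q := by linarith
  set G := (y - r * P * x) ^ 2 + (r * Q) ^ 2 * x ^ 2 with hG
  have hG0 : 0 ≤ G := by positivity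
  have hP2 : P ^ 2 ≤ (a₁ / 2) ^ 2 := by
    rw [← sq_abs P]; exact pow_le_pow_left₀ (abs_nonneg _) (hP.trans (by linarith)) 2
  have hQ2 : Q ^ 2 ≤ (3 * a₁ / 2) ^ 2 := by gcongr
  have h1 : G ≤ 2 * y ^ 2 + 3 * a₁ ^ 2 * (r ^ 2 * x ^ 2) := by
    have h2 : (r * P * x) ^ 2 ≤ (a₁ / 2) ^ 2 * (r ^ 2 * x ^ 2) := by
      rw [mul_pow, mul_pow, mul_comm (r ^ 2), mul_assoc]; gcongr
    have h3 : (r * Q) ^ 2 * x ^ 2 ≤ (3 * a₁ / 2) ^ 2 * (r ^ 2 * x ^ 2) := by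
      rw [mul_pow, mul_comm (r ^ 2), mul_assoc]; gcongr
    have : 0 ≤ a₁ ^ 2 * (r ^ 2 * x ^ 2) := by positivity
    nlinarith [sq_nonneg (y + (r * P * x))]
  have h2 : a₁ ^ 2 * (r ^ 2 * x ^ 2) ≤ a₁ ^ 2 / a₀ ^ 2 * ((α * r) ^ 2 * x ^ 2) := by
    calc a₁ ^ 2 * (r ^ 2 * x ^ 2) = a₁ ^ 2 / a₀ ^ 2 * ((a₀ * r) ^ 2 * x ^ 2) := by field_simp
      _ ≤ _ := by gcongr
  have h3 : G ≤ (2 + 3 * a₁ ^ 2 / a₀ ^ 2) * (y ^ 2 + (α * r) ^ 2 * x ^ 2) := by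
    have e : (2 + 3 * a₁ ^ 2 / a₀ ^ 2) * (y ^ 2 + (α * r) ^ 2 * x ^ 2) =
      2 * y ^ 2 + 3 * (a₁ ^ 2 / a₀ ^ 2 * ((α * r) ^ 2 * x ^ 2)) +
        (3 * a₁ ^ 2 / a₀ ^ 2 * y ^ 2 + 2 * ((α * r) ^ 2 * x ^ 2)) := by ring
    have : 0 ≤ 3 * a₁ ^ 2 / a₀ ^ 2 * y ^ 2 + 2 * ((α * r) ^ 2 * x ^ 2) := by positivity
    linarith
  have h4 : r * (G / (r * Q)) = 1 / Q * G := by field_simp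
  rw [h4, mul_assoc]
  have h5 : 1 / Q ≤ 2 / a₀ := by
    rw [div_le_div_iff₀ hQ0 ha₀]; linarith
  gcongr

/-- Energy estimate before the separating time, from stabilization. -/
theorem exists_energy_le_of_stabilization {a Θ : ℝ → ℝ} {a₀ a₁ : ℝ} (ha₀ : 0 < a₀)
    (ha : ∀ t : ℝ, 0 ≤ t → a₀ ≤ a t ∧ a t ≤ a₁) (hac : ContinuousOn a (Ici 0))
    (h_stab : StabilizationBound a Θ) :
    ∃ C M : ℝ, 1 ≤ C ∧ 0 ≤ M ∧ ∀ (r : ℝ) (x y : ℝ → ℝ), 0 < r →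
      IsOscillation (fun t => a t * r) x y → ∀ t : ℝ, 0 ≤ t →
        y t ^ 2 + (a t * r) ^ 2 * x t ^ 2 ≤
          C * Real.exp (M * (r * Θ t)) * (y 0 ^ 2 + (a 0 * r) ^ 2 * x 0 ^ 2) := by
  obtain ⟨α, hα, h_stab⟩ := h_stab
  have ha₁ : 0 < a₁ := ha₀.trans_le ((ha 0 le_rfl).1.trans (ha 0 le_rfl).2)
  -- The two factors pass from the energy with speed `a(t)` to the one with speed `α = a_∞` and
  -- back; the rate comes from `|a² - α²| = (a + α) |a - α|`.
  refine ⟨(1 + a₁ ^ 2 / α ^ 2) * (1 + α ^ 2 / a₀ ^ 2), (a₁ + α) / α, ?_, by positivity, ?_⟩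
  · have h1 : 0 ≤ a₁ ^ 2 / α ^ 2 := by positivity
    have h2 : 0 ≤ α ^ 2 / a₀ ^ 2 := by positivity
    nlinarith
  intro r x y hr h t ht
  set k : ℝ → ℝ := fun s => (a₁ + α) / α * r * |a s - α| with hk
  have h1 := h.energy_le_of_constant (β := α * r) (k := k) (by positivity) ht
    (by fun_prop) ?_
  · have h2 : ∫ s in (0 : ℝ)..t, k s ≤ (a₁ + α) / α * (r * Θ t) := by
      rw [hk, intervalIntegral.integral_const_mul, mul_assoc]
      gcongr
      exact h_stab t ht
    have h3 : y t ^ 2 + (a t * r) ^ 2 * x t ^ 2 ≤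
        (1 + a₁ ^ 2 / α ^ 2) * (y t ^ 2 + (α * r) ^ 2 * x t ^ 2) := by
      have h4 : (a t * r) ^ 2 * x t ^ 2 ≤ a₁ ^ 2 / α ^ 2 * ((α * r) ^ 2 * x t ^ 2) := by
        calc (a t * r) ^ 2 * x t ^ 2 ≤ (a₁ * r) ^ 2 * x t ^ 2 := by
              have := ha t ht
              have : 0 ≤ a t := by linarith
              gcongr
              linarith
          _ = _ := by field_simp
      have h5 : 0 ≤ a₁ ^ 2 / α ^ 2 * y t ^ 2 := by positivity
      have h6 : 0 ≤ (α * r) ^ 2 * x t ^ 2 := by positivity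
      linarith
    have h4 : y 0 ^ 2 + (α * r) ^ 2 * x 0 ^ 2 ≤
        (1 + α ^ 2 / a₀ ^ 2) * (y 0 ^ 2 + (a 0 * r) ^ 2 * x 0 ^ 2) := by
      have h4 : (α * r) ^ 2 * x 0 ^ 2 ≤ α ^ 2 / a₀ ^ 2 * ((a 0 * r) ^ 2 * x 0 ^ 2) := by
        calc (α * r) ^ 2 * x 0 ^ 2 = α ^ 2 / a₀ ^ 2 * ((a₀ * r) ^ 2 * x 0 ^ 2) := by field_simp
          _ ≤ _ := by
              have := (ha 0 le_rfl).1
              gcongr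
      have h5 : 0 ≤ α ^ 2 / a₀ ^ 2 * y 0 ^ 2 := by positivity
      have h6 : 0 ≤ (a 0 * r) ^ 2 * x 0 ^ 2 := by positivity
      linarith
    calc y t ^ 2 + (a t * r) ^ 2 * x t ^ 2
        ≤ (1 + a₁ ^ 2 / α ^ 2) * (y t ^ 2 + (α * r) ^ 2 * x t ^ 2) := h3
      _ ≤ (1 + a₁ ^ 2 / α ^ 2) * (((1 + α ^ 2 / a₀ ^ 2) * (y 0 ^ 2 + (a 0 * r) ^ 2 * x 0 ^ 2)) *
            Real.exp ((a₁ + α) / α * (r * Θ t))) := by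
          gcongr
          exact h1.trans (by gcongr)
      _ = _ := by ring
  · intro s hs
    have hs' := ha s hs
    have e : (a s * r) ^ 2 - (α * r) ^ 2 = r ^ 2 * (a s + α) * (a s - α) := by ring
    rw [e, abs_mul, abs_mul, abs_of_pos (by positivity : 0 < r ^ 2),
      abs_of_pos (by linarith : 0 < a s + α)]
    calc r ^ 2 * (a s + α) * |a s - α| / (α * r) = (a s + α) / α * r * |a s - α| := by field_simp
      _ ≤ _ := by simp only [hk]; gcongr; exact hs'.2

/-- Energy estimate in the zone `r Λ(t) ≥ N`. -/
theorem exists_energy_le_of_symbol {m : ℕ} (hm : 2 ≤ m) {a Θ Ξ Λ : ℝ → ℝ} {a₀ a₁ : ℝ}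
    (ha₀ : 0 < a₀) (ha : ∀ t : ℝ, 0 ≤ t → a₀ ≤ a t ∧ a t ≤ a₁)
    (hΘ_pos : ∀ t : ℝ, 0 ≤ t → 0 < Θ t) (hΞ_pos : ∀ t : ℝ, 0 ≤ t → 0 < Ξ t)
    (hΛ_pos : ∀ t : ℝ, 0 ≤ t → 0 < Λ t) (hΛ_mono : StrictMonoOn Λ (Ici 0))
    (h_deriv : DerivativeBounds m a Ξ) (h_dom : DominatedBy Λ Ξ) (h_tail : TailBound m Θ Ξ Λ)
    (B : ℝ) :
    ∃ N C M : ℝ, 1 ≤ N ∧ B ≤ N ∧ 1 ≤ C ∧ 0 ≤ M ∧ ∀ (r : ℝ) (x y : ℝ → ℝ), 0 < r →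
      IsOscillation (fun t => a t * r) x y → ∀ s t : ℝ, 0 ≤ s → s ≤ t → N ≤ r * Λ s →
        y t ^ 2 + (a t * r) ^ 2 * x t ^ 2 ≤
          C * Real.exp (M * (r * Θ s)) * (y s ^ 2 + (a s * r) ^ 2 * x s ^ 2) := by
  have ha₁ : a₀ ≤ a₁ := (ha 0 le_rfl).1.trans (ha 0 le_rfl).2
  have ha₁' : 0 < a₁ := ha₀.trans_le ha₁
  have hsym : IsSymbol Ξ m 0 (fun _ t => (a t : ℂ)) :=
    h_deriv.isSymbol (a₁ := a₁) fun t ht => abs_le.2 ⟨by linarith [ha t ht], (ha t ht).2⟩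
  -- All the available derivatives are spent: with `n = m - 1` the remainder has order `-m` and is
  -- merely continuous.
  obtain ⟨ε, ρ, hε, hρ, hd⟩ := exists_riccati_approximation ha₀ (fun t ht => (ha t ht).1) hsym
    (n := m - 1) (by omega)
  obtain ⟨Cε, hCε, hεb⟩ := hε.bound
  have hρc := hρ.continuousOn
  obtain ⟨Cρ, hCρ, hρb⟩ := hρ.bound
  rw [show m - 1 + 1 = m by omega] at hρb
  obtain ⟨C₀, hC₀, h_dom⟩ := h_dom
  obtain ⟨hint, K, hK⟩ := h_tail
  -- Since `r Ξ ≥ N / C₀` in the zone, `N ≥ C₀` makes the symbol bounds applicable and `N ≥ 2 C₀ Cε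
  -- / a₀` forces `|ε| ≤ a₀ / 2`. The entry `1` makes `(r Λ)^{-m} ≤ 1`, and `B` leaves room for
  -- further demands.
  set N := max (max 1 B) (max C₀ (2 * C₀ * Cε / a₀)) with hN
  have hN1 : 1 ≤ N := (le_max_left _ _).trans (le_max_left _ _)
  have hNC₀ : C₀ ≤ N := (le_max_left _ _).trans (le_max_right _ _)
  have hNε : 2 * C₀ * Cε / a₀ ≤ N := (le_max_right _ _).trans (le_max_right _ _)
  set C₁ := (2 + 4 * a₁ ^ 2 / a₀ ^ 2) * (3 * a₁ / 2) with hC₁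
  set C₂ := 2 / a₀ * (2 + 3 * a₁ ^ 2 / a₀ ^ 2) with hC₂
  refine ⟨N, max 1 (C₁ * C₂), 8 / a₀ * Cρ * |K|, hN1, (le_max_right _ _).trans (le_max_left _ _),
    le_max_left _ _, by positivity, ?_⟩
  intro r x y hr h s t hs hst hNs
  have hzone : ∀ τ ∈ Icc s t, 1 ≤ r * Ξ τ ∧ ‖ε r τ‖ ≤ a₀ / 2 := by
    intro τ hτ
    have hτ0 := hs.trans hτ.1
    have h1 : N ≤ r * (C₀ * Ξ τ) := by
      refine hNs.trans ?_
      gcongr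
      exact (hΛ_mono.monotoneOn hs hτ0 hτ.1).trans (h_dom τ hτ0)
    have h2 : 1 ≤ r * Ξ τ := by
      refine le_of_mul_le_mul_left ?_ hC₀; linarith
    refine ⟨h2, (hεb r τ hr hτ0 h2).trans ?_⟩
    rw [pow_one, ← div_eq_mul_inv, div_le_iff₀ (by linarith)]
    rw [div_le_iff₀ ha₀] at hNε
    refine le_of_mul_le_mul_left ?_ hC₀
    have : N * a₀ ≤ r * (C₀ * Ξ τ) * a₀ := by gcongr
    linarith
  have hP : ∀ τ ∈ Icc s t, |(ε r τ).re| ≤ a₀ / 2 := fun τ hτ =>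
    (Complex.abs_re_le_norm _).trans (hzone τ hτ).2
  have hQ : ∀ τ ∈ Icc s t, a₀ / 2 ≤ a τ + (ε r τ).im ∧ a τ + (ε r τ).im ≤ 3 * a₁ / 2 := by
    intro τ hτ
    have h1 := abs_le.1 ((Complex.abs_im_le_norm _).trans (hzone τ hτ).2)
    have h2 := ha τ (hs.trans hτ.1)
    constructor <;> linarith
  have hdp : ∀ τ : ℝ, 0 ≤ τ → HasDerivWithinAt (fun τ => r * (ε r τ).re)
      (r ^ 2 * (ρ r τ).re - (r * (ε r τ).re) ^ 2 + (r * (a τ + (ε r τ).im)) ^ 2 - (a τ * r) ^ 2)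
      (Ici 0) τ := by
    intro τ hτ
    have h1 := (Complex.reCLM.hasFDerivAt.comp_hasDerivWithinAt τ (hd r τ hr hτ)).const_mul r
    refine (h1.congr_of_eventuallyEq (Eventually.of_forall fun s => ?_) ?_).congr_deriv ?_
    · simp
    · simp
    · simp [pow_two]; ring
  have hdq : ∀ τ : ℝ, 0 ≤ τ → HasDerivWithinAt (fun τ => r * (a τ + (ε r τ).im))
      (r ^ 2 * (ρ r τ).im - 2 * (r * (ε r τ).re) * (r * (a τ + (ε r τ).im))) (Ici 0) τ := by
    intro τ hτ
    have h1 := (Complex.imCLM.hasFDerivAt.comp_hasDerivWithinAt τ (hd r τ hr hτ)).const_mul r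
    refine (h1.congr_of_eventuallyEq (Eventually.of_forall fun s => ?_) ?_).congr_deriv ?_
    · simp
    · simp
    · simp [pow_two]; ring
  -- The rate `(|ρ₁| + 3 |ρ₂|) / q` is at most `4 r² |ρ|` divided by `r a₀ / 2`.
  set k : ℝ → ℝ := fun τ => 8 / a₀ * r * ‖ρ r τ‖ with hk
  have hkc : ContinuousOn k (Ici 0) := (hρc r hr).norm.const_mul _ 
  have h1 := h.energy_le_of_riccati (k := k) (ρ₁ := fun τ => r ^ 2 * (ρ r τ).re)
    (ρ₂ := fun τ => r ^ 2 * (ρ r τ).im) hs hst hdp hdq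
    (fun τ hτ => mul_pos hr (by linarith [(hQ τ hτ).1])) hkc ?_
  · have hint' : IntervalIntegrable (fun τ => (Ξ τ ^ m)⁻¹) volume s t :=
      (intervalIntegrable_iff_integrableOn_Ioc_of_le hst).2
        (hint.mono_set fun τ hτ => hs.trans hτ.1.le)
    have hI : ∫ τ in s..t, (Ξ τ ^ m)⁻¹ ≤ |K| * Θ s * (Λ s ^ m)⁻¹ := by
      have h2 : ∫ τ in s..t, (Ξ τ ^ m)⁻¹ ≤ ∫ τ in Ioi s, (Ξ τ ^ m)⁻¹ := by
        rw [intervalIntegral.integral_of_le hst]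
        refine setIntegral_mono_set (hint.mono_set fun τ hτ => hs.trans (le_of_lt hτ)) ?_
          (Eventually.of_forall fun τ hτ => hτ.1)
        refine (ae_restrict_iff' measurableSet_Ioi).2 (Eventually.of_forall fun τ hτ => ?_)
        have := hΞ_pos τ (hs.trans (le_of_lt hτ))
        simp only [Pi.zero_apply]; positivity
      refine h2.trans ?_
      have h3 := (hK s hs).trans (le_abs_self K)
      have hΘs := hΘ_pos s hs
      have hΛs := pow_pos (hΛ_pos s hs) m
      rw [← div_eq_mul_inv, le_div_iff₀ hΛs]
      calc _ = (Λ s ^ m * (Θ s)⁻¹ * ∫ τ in Ioi s, (Ξ τ ^ m)⁻¹) * Θ s := by field_simp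
        _ ≤ _ := by gcongr
    have hJ : ∫ τ in s..t, k τ ≤ 8 / a₀ * Cρ * |K| * (r * Θ s) := by
      have h2 : ∫ τ in s..t, k τ ≤ ∫ τ in s..t, 8 / a₀ * r * Cρ * (r ^ m)⁻¹ * (Ξ τ ^ m)⁻¹ := by
        refine intervalIntegral.integral_mono_on hst ?_ (hint'.const_mul _) fun τ hτ => ?_
        · refine (hkc.mono fun τ hτ => ?_).intervalIntegrable
          rw [uIcc_of_le hst] at hτ
          exact hs.trans hτ.1
        · have := hρb r τ hr (hs.trans hτ.1) (hzone τ hτ).1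
          rw [mul_pow, mul_inv] at this
          calc 8 / a₀ * r * ‖ρ r τ‖ ≤ 8 / a₀ * r * (Cρ * ((r ^ m)⁻¹ * (Ξ τ ^ m)⁻¹)) := by gcongr
            _ = _ := by ring
      refine h2.trans ?_
      rw [intervalIntegral.integral_const_mul]
      have h3 : (r ^ m)⁻¹ * (Λ s ^ m)⁻¹ ≤ 1 := by
        rw [← mul_inv, ← mul_pow]
        exact inv_le_one_of_one_le₀ (one_le_pow₀ (hN1.trans hNs))
      have hΘs := hΘ_pos s hs
      calc 8 / a₀ * r * Cρ * (r ^ m)⁻¹ * ∫ τ in s..t, (Ξ τ ^ m)⁻¹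
          ≤ 8 / a₀ * r * Cρ * (r ^ m)⁻¹ * (|K| * Θ s * (Λ s ^ m)⁻¹) := by gcongr
        _ = 8 / a₀ * Cρ * |K| * (r * Θ s) * ((r ^ m)⁻¹ * (Λ s ^ m)⁻¹) := by ring
        _ ≤ 8 / a₀ * Cρ * |K| * (r * Θ s) * 1 := by gcongr
        _ = _ := by ring
    have ht' : t ∈ Icc s t := right_mem_Icc.2 hst
    have hs' : s ∈ Icc s t := left_mem_Icc.2 hst
    have hat := ha t (hs.trans hst)
    have has := ha s hs
    have hup := energy_le_riccati_functional (x := x t) (y := y t) ha₀ hr hat.1 hat.2 (hP t ht')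
      (hQ t ht').1 (hQ t ht').2
    have hlow := riccati_functional_le_energy (x := x s) (y := y s) ha₀ hr has.1 has.2 (hP s hs')
      (hQ s hs').1 (hQ s hs').2
    rw [← hC₁] at hup
    rw [← hC₂] at hlow
    have hC₁0 : 0 ≤ C₁ := by positivity
    refine hup.trans ?_
    set e := y s ^ 2 + (a s * r) ^ 2 * x s ^ 2 with he
    have he0 : 0 ≤ e := by positivity
    generalize ((y t - r * (ε r t).re * x t) ^ 2 + (r * (a t + (ε r t).im)) ^ 2 * x t ^ 2) /
      (r * (a t + (ε r t).im)) = Ft at h1 ⊢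
    generalize ((y s - r * (ε r s).re * x s) ^ 2 + (r * (a s + (ε r s).im)) ^ 2 * x s ^ 2) /
      (r * (a s + (ε r s).im)) = Fs at h1 hlow
    calc C₁ * (r * Ft) ≤ C₁ * (r * (Fs * Real.exp (∫ τ in s..t, k τ))) := by gcongr
      _ = C₁ * ((r * Fs) * Real.exp (∫ τ in s..t, k τ)) := by ring
      _ ≤ C₁ * ((C₂ * e) * Real.exp (8 / a₀ * Cρ * |K| * (r * Θ s))) := by
          gcongr
      _ = (C₁ * C₂) * Real.exp (8 / a₀ * Cρ * |K| * (r * Θ s)) * e := by ring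
      _ ≤ _ := by gcongr; exact le_max_right _ _
  · intro τ hτ
    have h2 := (hQ τ hτ).1
    have h3 := Complex.abs_re_le_norm (ρ r τ)
    have h4 := Complex.abs_im_le_norm (ρ r τ)
    rw [abs_mul, abs_mul, abs_of_pos (by positivity : 0 < r ^ 2)]
    have h5 : 0 < r * (a₀ / 2) := by positivity
    calc (r ^ 2 * |(ρ r τ).re| + 3 * (r ^ 2 * |(ρ r τ).im|)) / (r * (a τ + (ε r τ).im))
        ≤ (r ^ 2 * ‖ρ r τ‖ + 3 * (r ^ 2 * ‖ρ r τ‖)) / (r * (a₀ / 2)) := by gcongr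
      _ = k τ := by simp only [hk]; field_simp; ring

/-! ### Joining the two zones -/

theorem exists_eq_of_tendsto_atTop {Λ : ℝ → ℝ} (hΛ_cont : ContinuousOn Λ (Ici 0))
    (hΛ_lim : Tendsto Λ atTop atTop) {τ : ℝ} (hτ : Λ 0 ≤ τ) : ∃ t : ℝ, 0 ≤ t ∧ Λ t = τ := by
  obtain ⟨T, hT, hT0⟩ := ((hΛ_lim.eventually_ge_atTop τ).and (eventually_ge_atTop 0)).exists
  obtain ⟨t, ht, h⟩ := intermediate_value_Icc hT0 (hΛ_cont.mono fun s hs => hs.1) ⟨hτ, hT⟩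
  exact ⟨t, ht.1, h⟩

/-- Energy estimate for all times, with the sharp form of the exponent. -/
theorem exists_energy_le {m : ℕ} (hm : 2 ≤ m) {a Θ Ξ Λ : ℝ → ℝ} {a₀ a₁ : ℝ}
    (ha₀ : 0 < a₀) (ha : ∀ t : ℝ, 0 ≤ t → a₀ ≤ a t ∧ a t ≤ a₁)
    (hΘ_pos : ∀ t : ℝ, 0 ≤ t → 0 < Θ t) (hΘ_mono : MonotoneOn Θ (Ici 0))
    (hΞ_pos : ∀ t : ℝ, 0 ≤ t → 0 < Ξ t)
    (hΛ_pos : ∀ t : ℝ, 0 ≤ t → 0 < Λ t) (hΛ_mono : StrictMonoOn Λ (Ici 0))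
    (hΛ_cont : ContinuousOn Λ (Ici 0)) (hΛ_lim : Tendsto Λ atTop atTop)
    (h_stab : StabilizationBound a Θ) (h_deriv : DerivativeBounds m a Ξ)
    (h_ratio : MonotoneOn (fun t => Θ t / Λ t) (Ici 0))
    (h_dom : DominatedBy Λ Ξ) (h_tail : TailBound m Θ Ξ Λ) (R : ℝ) :
    ∃ N C : ℝ, 0 < N ∧ Λ 0 * R ≤ N ∧ 1 ≤ N ∧ 1 ≤ C ∧
      ∀ (r : ℝ) (x y : ℝ → ℝ), 0 < r → r ≤ R → IsOscillation (fun t => a t * r) x y →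
        ∀ t : ℝ, 0 ≤ t → y t ^ 2 + (a t * r) ^ 2 * x t ^ 2 ≤
          C * Real.exp (2 * r * Θ (rateInv Λ (N / r))) * (y 0 ^ 2 + (a 0 * r) ^ 2 * x 0 ^ 2) := by
  obtain ⟨C₁, M₁, hC₁, hM₁, H₁⟩ :=
    exists_energy_le_of_stabilization ha₀ ha h_deriv.1.continuousOn h_stab
  obtain ⟨N, C₂, M₂, hN1, hNR, hC₂, hM₂, H₂⟩ := exists_energy_le_of_symbol hm ha₀ ha hΘ_pos hΞ_pos
    hΛ_pos hΛ_mono h_deriv h_dom h_tail (Λ 0 * R)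
  -- Chosen so that `M₁ + M₂ ≤ 2 κ`: enlarging `N` by `κ` absorbs the exponent constant into the
  -- weight.
  set κ := max 1 ((M₁ + M₂) / 2) with hκ
  have hκ1 : 1 ≤ κ := le_max_left _ _
  have hκM : (M₁ + M₂) / 2 ≤ κ := le_max_right _ _
  have hNκ : N ≤ κ * N := le_mul_of_one_le_left (by linarith) hκ1
  refine ⟨κ * N, C₁ * C₂, by positivity, hNR.trans hNκ, hN1.trans hNκ, by nlinarith, ?_⟩
  intro r x y hr hrR h t ht
  -- `N ≥ Λ(0) R` guarantees that the separating time exists for every frequency `r ≤ R`.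
  have hΛ0 : Λ 0 ≤ N / r := by
    rw [le_div_iff₀ hr]
    refine le_trans ?_ hNR
    have := hΛ_pos 0 le_rfl
    gcongr
  obtain ⟨τ, hτ, hτN⟩ := exists_eq_of_tendsto_atTop hΛ_cont hΛ_lim hΛ0
  have hle : N / r ≤ κ * N / r := by gcongr
  obtain ⟨T, hT, hTN⟩ := exists_eq_of_tendsto_atTop hΛ_cont hΛ_lim (hΛ0.trans hle)
  have hτT : τ ≤ T := by
    rw [← hΛ_mono.le_iff_le hτ hT, hτN, hTN]; exact hle
  rw [← hTN, rateInv_apply hΛ_mono hT]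
  -- Here `Λ(T) = κ Λ(τ)`, so this is `Θ(τ)/Λ(τ) ≤ Θ(T)/Λ(T)` with denominators cleared.
  have hΘT : κ * Θ τ ≤ Θ T := by
    have h1 := h_ratio hτ hT hτT
    simp only [hτN, hTN] at h1
    rw [div_le_div_iff₀ (by positivity) (by positivity)] at h1
    have h2 : 0 < N / r := by positivity
    refine le_of_mul_le_mul_right ?_ h2
    calc κ * Θ τ * (N / r) = Θ τ * (κ * N / r) := by ring
      _ ≤ _ := h1
  have hΘτ := hΘ_pos τ hτ
  have hexp : (M₁ + M₂) * (r * Θ τ) ≤ 2 * r * Θ T := by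
    calc (M₁ + M₂) * (r * Θ τ) = 2 * r * ((M₁ + M₂) / 2 * Θ τ) := by ring
      _ ≤ 2 * r * (κ * Θ τ) := by gcongr
      _ ≤ _ := by gcongr
  set e := y 0 ^ 2 + (a 0 * r) ^ 2 * x 0 ^ 2 with he
  have he0 : 0 ≤ e := by positivity
  rcases le_total t τ with htτ | hτt
  · refine (H₁ r x y hr h t ht).trans ?_
    have h1 : M₁ * (r * Θ t) ≤ 2 * r * Θ T := by
      refine le_trans ?_ hexp
      have := hΘ_mono ht hτ htτ
      have := hΘ_pos t ht
      gcongr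
      linarith
    have : C₁ ≤ C₁ * C₂ := le_mul_of_one_le_right (by linarith) hC₂
    gcongr
  · have h1 := H₁ r x y hr h τ hτ
    have h2 := H₂ r x y hr h τ t hτ hτt (by rw [hτN]; field_simp; rfl)
    refine h2.trans ?_
    calc _ ≤ C₂ * Real.exp (M₂ * (r * Θ τ)) * (C₁ * Real.exp (M₁ * (r * Θ τ)) * e) := by gcongr
      _ = C₁ * C₂ * Real.exp ((M₁ + M₂) * (r * Θ τ)) * e := by
          rw [add_mul, Real.exp_add]; ring
      _ ≤ _ := by gcongr

/-! ### Linear differential equations in Banach spaces -/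

section LinearODE

variable {E : Type*} [NormedAddCommGroup E] [NormedSpace ℝ E]

/-- The terms of the Dyson series of `X' = A X`, `X(0) = x₀`. -/
def dysonTerm (A : ℝ → E →L[ℝ] E) (x₀ : E) : ℕ → ℝ → E
  | 0 => fun _ => x₀
  | n + 1 => fun t => ∫ s in (0 : ℝ)..t, A s (dysonTerm A x₀ n s)

variable {A : ℝ → E →L[ℝ] E} {K : ℝ}

theorem exists_linear_solution [CompleteSpace E] (hA : Continuous A) (hK : ∀ t, ‖A t‖ ≤ K)
    (x₀ : E) : ∃ X : ℝ → E, X 0 = x₀ ∧ ∀ t, HasDerivAt X (A t (X t)) t := by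
  have hK0 : 0 ≤ K := (norm_nonneg _).trans (hK 0)
  have hc : ∀ n, Continuous (dysonTerm A x₀ n) := by
    intro n
    induction n with
    | zero => exact continuous_const
    | succ n ih =>
      have h1 : Continuous fun s => A s (dysonTerm A x₀ n s) := hA.clm_apply ih
      exact continuous_iff_continuousAt.2 fun t =>
        (h1.integral_hasStrictDerivAt 0 t).hasDerivAt.continuousAt
  have hd : ∀ n t, HasDerivAt (dysonTerm A x₀ (n + 1)) (A t (dysonTerm A x₀ n t)) t := fun n t =>
    ((hA.clm_apply (hc n)).integral_hasStrictDerivAt 0 t).hasDerivAt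
  have hb : ∀ n t, ‖dysonTerm A x₀ n t‖ ≤ ‖x₀‖ * ((K * |t|) ^ n / n.factorial) := by
    intro n
    induction n with
    | zero => intro t; simp [dysonTerm]
    | succ n ih =>
      intro t
      have hi : IntegrableOn (fun s : ℝ => ‖x₀‖ * K ^ (n + 1) / n.factorial * |s - 0| ^ n)
          (uIoc 0 t) volume := by
        refine Continuous.integrableOn_uIoc ?_
        fun_prop
      calc ‖dysonTerm A x₀ (n + 1) t‖
          ≤ ∫ s in uIoc 0 t, ‖A s (dysonTerm A x₀ n s)‖ :=
            intervalIntegral.norm_integral_le_integral_norm_uIoc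
        _ ≤ ∫ s in uIoc 0 t, ‖x₀‖ * K ^ (n + 1) / n.factorial * |s - 0| ^ n := by
            refine integral_mono_of_nonneg (Eventually.of_forall fun s => norm_nonneg _) hi
              (Eventually.of_forall fun s => ?_)
            calc ‖A s (dysonTerm A x₀ n s)‖
                ≤ K * (‖x₀‖ * ((K * |s|) ^ n / n.factorial)) :=
                  ((A s).le_opNorm _).trans (mul_le_mul (hK s) (ih s) (norm_nonneg _) hK0)
              _ = _ := by simp only [sub_zero, mul_pow]; ring
        _ = _ := by
            rw [integral_const_mul, integral_pow_abs_sub_uIoc, Nat.factorial_succ, sub_zero]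
            push_cast
            rw [mul_pow]
            field_simp
  have hs : ∀ t, Summable fun n => dysonTerm A x₀ n t := fun t =>
    Summable.of_norm_bounded ((Real.summable_pow_div_factorial (K * |t|)).mul_left _)
      fun n => hb n t
  refine ⟨fun t => ∑' n, dysonTerm A x₀ n t, ?_, fun t => ?_⟩
  · simp only
    rw [tsum_eq_single 0]
    · rfl
    · intro n hn
      obtain ⟨k, rfl⟩ := Nat.exists_eq_succ_of_ne_zero hn
      simp [dysonTerm]
  · set T := |t| + 1 with hT
    -- Each Dyson term differentiates to `A` applied to its predecessor, the zeroth to `0`; `v`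
    -- majorizes these derivatives uniformly on the ball of radius `|t| + 1`.
    let g' : ℕ → ℝ → E := fun n => Nat.casesOn n (fun _ => 0) fun k t => A t (dysonTerm A x₀ k t)
    let v : ℕ → ℝ := fun n => Nat.casesOn n 0
      fun k => K * (‖x₀‖ * ((K * T) ^ k / k.factorial))
    have hv : Summable v := by
      rw [← summable_nat_add_iff 1]
      exact ((Real.summable_pow_div_factorial (K * T)).mul_left _).mul_left _
    have h1 := hasDerivAt_tsum_of_isPreconnected (g := dysonTerm A x₀) (g' := g') (y₀ := 0) (y := t)
      hv (Metric.isOpen_ball (x := (0 : ℝ)) (ε := T)) (convex_ball (0 : ℝ) T).isPreconnected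
      ?_ ?_ (Metric.mem_ball_self (by positivity)) (hs 0) (by simp [hT])
    · refine h1.congr_deriv ?_
      have h2 : Summable fun n => A t (dysonTerm A x₀ n t) := (A t).summable (hs t)
      rw [(A t).map_tsum (hs t), ((summable_nat_add_iff (f := fun n => g' n t) 1).1 h2).tsum_eq_zero_add]
      simp [g']
    · intro n y _
      cases n with
      | zero => exact hasDerivAt_const y x₀
      | succ n => exact hd n y
    · intro n y hy
      cases n with
      | zero => simp [g', v]
      | succ n =>
        have hy' : |y| ≤ T := by
          have := Metric.mem_ball.1 hy
          rw [dist_zero_right, Real.norm_eq_abs] at this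
          exact this.le
        refine ((A y).le_opNorm _).trans (mul_le_mul (hK y) ((hb n y).trans ?_) (norm_nonneg _) hK0)
        gcongr

theorem linear_solution_unique (hK : ∀ t, ‖A t‖ ≤ K) {X Y : ℝ → E}
    (hX : ∀ t : ℝ, 0 ≤ t → HasDerivWithinAt X (A t (X t)) (Ici 0) t)
    (hY : ∀ t : ℝ, 0 ≤ t → HasDerivWithinAt Y (A t (Y t)) (Ici 0) t)
    (h0 : X 0 = Y 0) {t : ℝ} (ht : 0 ≤ t) : X t = Y t := by
  have hcont : ∀ {Z : ℝ → E}, (∀ t : ℝ, 0 ≤ t → HasDerivWithinAt Z (A t (Z t)) (Ici 0) t) →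
      ContinuousOn Z (Icc 0 t) := fun hZ s hs =>
    (hZ s hs.1).continuousWithinAt.mono Icc_subset_Ici_self
  have hder : ∀ {Z : ℝ → E}, (∀ t : ℝ, 0 ≤ t → HasDerivWithinAt Z (A t (Z t)) (Ici 0) t) →
      ∀ s ∈ Ico 0 t, HasDerivWithinAt Z (A s (Z s)) (Ici s) s := fun hZ s hs =>
    (hZ s hs.1).mono (Ici_subset_Ici.2 hs.1)
  exact ODE_solution_unique (v := fun s x => A s x) (K := K.toNNReal)
    (fun s => (A s).lipschitz.weaken (by
      rw [← NNReal.coe_le_coe, coe_nnnorm]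
      exact (hK s).trans (Real.le_coe_toNNReal K)))
    (hcont hX) (hder hX) (hcont hY) (hder hY) h0 (right_mem_Icc.2 ht)

/-- The generator `(y, z) ↦ (z, -α T y)` of `y'' + α T y = 0`. -/
def oscillatorGenerator (T : E →L[ℝ] E) (α : ℝ) : E × E →L[ℝ] E × E :=
  (ContinuousLinearMap.snd ℝ E E).prod (-(α • (T.comp (ContinuousLinearMap.fst ℝ E E))))

theorem oscillatorGenerator_apply (T : E →L[ℝ] E) (α : ℝ) (x : E × E) :
    oscillatorGenerator T α x = (x.2, -(α • T x.1)) := rfl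

theorem norm_oscillatorGenerator_le (T : E →L[ℝ] E) {α β : ℝ} (hα : |α| ≤ β) :
    ‖oscillatorGenerator T α‖ ≤ 1 + β * ‖T‖ := by
  have hβ : 0 ≤ β := (abs_nonneg _).trans hα
  refine ContinuousLinearMap.opNorm_le_bound _ (by positivity) fun x => ?_
  rw [oscillatorGenerator_apply, Prod.norm_def]
  have h1 : ‖x.2‖ ≤ ‖x‖ := norm_snd_le x
  have h2 : ‖-(α • T x.1)‖ ≤ β * ‖T‖ * ‖x‖ := by
    rw [norm_neg, norm_smul, Real.norm_eq_abs, mul_assoc]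
    have := (T.le_opNorm x.1).trans (mul_le_mul_of_nonneg_left (norm_fst_le x) (norm_nonneg _))
    gcongr
  have h3 : 0 ≤ β * ‖T‖ * ‖x‖ := by positivity
  rw [add_mul, one_mul]
  exact max_le (by linarith) (by linarith [norm_nonneg x])

theorem continuous_oscillatorGenerator (T : E →L[ℝ] E) : Continuous (oscillatorGenerator T) := by
  have h : oscillatorGenerator T = fun α : ℝ => oscillatorGenerator T 0 +
      α • (0 : E × E →L[ℝ] E).prod (-(T.comp (ContinuousLinearMap.fst ℝ E E))) := by
    ext α x <;> simp [oscillatorGenerator]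
  rw [h]
  fun_prop

variable {a : ℝ → ℝ} {a₁ : ℝ}

theorem exists_oscillator_solution [CompleteSpace E] (ha : ∀ t : ℝ, 0 ≤ t → |a t| ≤ a₁)
    (hac : ContinuousOn a (Ici 0)) (T : E →L[ℝ] E) (y₀ z₀ : E) :
    ∃ Y Z : ℝ → E, Y 0 = y₀ ∧ Z 0 = z₀ ∧ ∀ t : ℝ, 0 ≤ t →
      HasDerivWithinAt Y (Z t) (Ici 0) t ∧
        HasDerivWithinAt Z (-(a t ^ 2 • T (Y t))) (Ici 0) t := by
  have hb : Continuous fun t : ℝ => a (max t 0) ^ 2 :=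
    (hac.comp_continuous (by fun_prop) fun x => mem_Ici.2 (le_max_right _ _)).pow 2
  obtain ⟨X, hX0, hX⟩ := exists_linear_solution (K := 1 + a₁ ^ 2 * ‖T‖)
    ((continuous_oscillatorGenerator T).comp hb) (fun t => norm_oscillatorGenerator_le T (by
      rw [abs_pow]
      exact pow_le_pow_left₀ (abs_nonneg _) (ha _ (le_max_right _ _)) 2)) (y₀, z₀)
  refine ⟨fun t => (X t).1, fun t => (X t).2, by simp [hX0], by simp [hX0], fun t ht => ?_⟩
  have h := (hX t).hasDerivWithinAt (s := Ici 0)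
  simp only [Function.comp, oscillatorGenerator_apply, max_eq_left ht] at h
  exact ⟨(ContinuousLinearMap.fst ℝ E E).hasFDerivAt.comp_hasDerivWithinAt t h,
    (ContinuousLinearMap.snd ℝ E E).hasFDerivAt.comp_hasDerivWithinAt t h⟩

theorem oscillator_solution_unique (ha : ∀ t : ℝ, 0 ≤ t → |a t| ≤ a₁) (T : E →L[ℝ] E)
    {Y Z Y' Z' : ℝ → E}
    (h : ∀ t : ℝ, 0 ≤ t → HasDerivWithinAt Y (Z t) (Ici 0) t ∧
      HasDerivWithinAt Z (-(a t ^ 2 • T (Y t))) (Ici 0) t)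
    (h' : ∀ t : ℝ, 0 ≤ t → HasDerivWithinAt Y' (Z' t) (Ici 0) t ∧
      HasDerivWithinAt Z' (-(a t ^ 2 • T (Y' t))) (Ici 0) t)
    (hY : Y 0 = Y' 0) (hZ : Z 0 = Z' 0) {t : ℝ} (ht : 0 ≤ t) : Y t = Y' t ∧ Z t = Z' t := by
  have key : ∀ {Y Z : ℝ → E}, (∀ t : ℝ, 0 ≤ t → HasDerivWithinAt Y (Z t) (Ici 0) t ∧
      HasDerivWithinAt Z (-(a t ^ 2 • T (Y t))) (Ici 0) t) → ∀ t : ℝ, 0 ≤ t →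
      HasDerivWithinAt (fun s => (Y s, Z s))
        (oscillatorGenerator T (a (max t 0) ^ 2) (Y t, Z t)) (Ici 0) t := by
    intro Y Z h t ht
    rw [oscillatorGenerator_apply, max_eq_left ht]
    exact (h t ht).1.prodMk (h t ht).2
  have := linear_solution_unique (A := fun t => oscillatorGenerator T (a (max t 0) ^ 2))
    (K := 1 + a₁ ^ 2 * ‖T‖) (fun t => norm_oscillatorGenerator_le T (by
      rw [abs_pow]
      exact pow_le_pow_left₀ (abs_nonneg _) (ha _ (le_max_right _ _)) 2)) (key h) (key h')
    (by simp [hY, hZ]) ht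
  exact Prod.ext_iff.1 this

end LinearODE

/-! ### Multiplication operators -/

/-- Multiplication of square integrable functions by bounded continuous functions. -/
def multiplier (d : ℕ) : ((Fin d → ℝ) →ᵇ ℂ) →L[ℂ]
    Lp ℂ 2 (cubeMeasure d) →L[ℂ] Lp ℂ 2 (cubeMeasure d) :=
  ((ContinuousLinearMap.mul ℂ ℂ).holderL (cubeMeasure d) ∞ 2 2).comp
    (BoundedContinuousFunction.toLp ∞ (cubeMeasure d) ℂ)

variable {d : ℕ}

theorem coeFn_multiplier (φ : (Fin d → ℝ) →ᵇ ℂ)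
    (f : Lp ℂ 2 (cubeMeasure d)) :
    multiplier d φ f =ᵐ[cubeMeasure d] fun θ => φ θ * f θ := by
  have h1 := (ContinuousLinearMap.mul ℂ ℂ).coeFn_holder (r := 2)
    (BoundedContinuousFunction.toLp ∞ (cubeMeasure d) ℂ φ) f
  filter_upwards [h1, BoundedContinuousFunction.coeFn_toLp ∞ (cubeMeasure d) ℂ φ] with θ h2 h3
  rw [h3] at h2
  exact h2

theorem multiplier_mul (φ ψ : (Fin d → ℝ) →ᵇ ℂ)
    (f : Lp ℂ 2 (cubeMeasure d)) :
    multiplier d (φ * ψ) f = multiplier d φ (multiplier d ψ f) := by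
  refine Lp.ext ?_
  filter_upwards [coeFn_multiplier (φ * ψ) f, coeFn_multiplier φ (multiplier d ψ f),
    coeFn_multiplier ψ f] with θ h1 h2 h3
  rw [h1, h2, h3, BoundedContinuousFunction.mul_apply, mul_assoc]

theorem multiplier_one (f : Lp ℂ 2 (cubeMeasure d)) : multiplier d 1 f = f := by
  refine Lp.ext ?_
  filter_upwards [coeFn_multiplier 1 f] with θ h1
  rw [h1]; simp

/-- `e^{-i k·θ}` as a bounded continuous function. -/
def characterBCF (k : Fin d → ℤ) : (Fin d → ℝ) →ᵇ ℂ :=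
  BoundedContinuousFunction.ofNormedAddCommGroup (character k) (continuous_character k) 1
    fun θ => (norm_character k θ).le

theorem characterBCF_apply (k : Fin d → ℤ) (θ : Fin d → ℝ) :
    characterBCF k θ = character k θ := rfl

theorem character_add (k l : Fin d → ℤ) (θ : Fin d → ℝ) :
    character (k + l) θ = character k θ * character l θ := by
  unfold character
  rw [← Complex.exp_add]
  congr 1
  simp only [Pi.add_apply, Int.cast_add, add_mul, Finset.sum_add_distrib]
  push_cast
  ring

theorem multiplier_character (k l : Fin d → ℤ) :
    multiplier d (characterBCF l) ((memLp_character k).toLp (character k)) =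
      (memLp_character (k + l)).toLp (character (k + l)) := by
  refine Lp.ext ?_
  filter_upwards [coeFn_multiplier (characterBCF l) ((memLp_character k).toLp (character k)),
    (memLp_character k).coeFn_toLp, (memLp_character (k + l)).coeFn_toLp] with θ h1 h2 h3
  rw [h1, h2, h3, characterBCF_apply, character_add, mul_comm]

/-! ### The symbol of the discrete Laplacian -/

theorem norm_xi_sq (θ : Fin d → ℝ) : ‖xi θ‖ ^ 2 = ∑ j, (2 * Real.sin (θ j / 2)) ^ 2 := by
  rw [EuclideanSpace.norm_sq_eq]
  simp [xi, mul_pow]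

theorem norm_xi_sq_le (θ : Fin d → ℝ) : ‖xi θ‖ ^ 2 ≤ 4 * d := by
  rw [norm_xi_sq]
  calc ∑ j, (2 * Real.sin (θ j / 2)) ^ 2 ≤ ∑ _j : Fin d, (4 : ℝ) := by
        refine Finset.sum_le_sum fun j _ => ?_
        nlinarith [Real.sin_sq_le_one (θ j / 2)]
    _ = 4 * d := by simp; ring

/-- `|ξ(θ)|²` as a bounded continuous function. -/
def xiSqBCF (d : ℕ) : (Fin d → ℝ) →ᵇ ℂ :=
  BoundedContinuousFunction.ofNormedAddCommGroup (fun θ => ((‖xi θ‖ ^ 2 : ℝ) : ℂ))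
    (by simp_rw [norm_xi_sq]; fun_prop) (4 * d) fun θ => by
      rw [Complex.norm_real, Real.norm_of_nonneg (by positivity)]
      exact norm_xi_sq_le θ

theorem xiSqBCF_apply (θ : Fin d → ℝ) : xiSqBCF d θ = ((‖xi θ‖ ^ 2 : ℝ) : ℂ) := rfl

theorem character_single (j : Fin d) (c : ℤ) (θ : Fin d → ℝ) :
    character (Pi.single j c) θ = Complex.exp (-(Complex.I * ((c * θ j : ℝ) : ℂ))) := by
  unfold character
  rw [Finset.sum_eq_single j (fun i _ hi => by simp [hi]) (by simp)]
  simp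

theorem character_single_add (j : Fin d) (θ : Fin d → ℝ) :
    character (-Pi.single j 1) θ + character (Pi.single j 1) θ - 2 =
      -(((2 * Real.sin (θ j / 2)) ^ 2 : ℝ) : ℂ) := by
  have h1 : character (Pi.single j 1) θ = Complex.exp (-(θ j) * Complex.I) := by
    rw [character_single]; congr 1; push_cast; ring
  have h2 : character (-Pi.single j 1) θ = Complex.exp (θ j * Complex.I) := by
    rw [← Pi.single_neg, character_single]; congr 1; push_cast; ring
  rw [h1, h2, ← Complex.two_cos]
  have h3 : Real.cos (θ j) = 1 - 2 * Real.sin (θ j / 2) ^ 2 := by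
    rw [← Real.cos_two_mul_eq_one_sub]; congr 1; ring
  rw [← Complex.ofReal_cos, h3]
  push_cast
  ring

theorem norm_character_single_sub_one (j : Fin d) (θ : Fin d → ℝ) :
    ‖character (-Pi.single j 1) θ - 1‖ ^ 2 = (2 * Real.sin (θ j / 2)) ^ 2 := by
  have h2 : character (-Pi.single j 1) θ = Complex.exp (Complex.I * (θ j : ℝ)) := by
    rw [← Pi.single_neg, character_single]; congr 1; push_cast; ring
  rw [h2, Complex.norm_exp_I_mul_ofReal_sub_one, Real.norm_eq_abs, sq_abs]

/-! ### The Fourier transform as a bounded operator -/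

theorem dtft_add (f g : L2Lattice d) : dtft (f + g) = dtft f + dtft g := by
  refine (hasSum_dtft (f + g)).unique ?_
  convert (hasSum_dtft f).add (hasSum_dtft g) using 2 with k
  rw [lp.coeFn_add, Pi.add_apply, add_smul]

theorem dtft_smul (c : ℂ) (f : L2Lattice d) : dtft (c • f) = c • dtft f := by
  refine (hasSum_dtft (c • f)).unique ?_
  convert (hasSum_dtft f).const_smul c using 2 with k
  rw [lp.coeFn_smul, Pi.smul_apply, smul_assoc]

/-- Parseval: the characters are orthogonal with squared norm `(2π)^d`, and pairing the convergent
series with its sum leaves only diagonal terms. -/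
theorem norm_dtft_sq (f : L2Lattice d) :
    ‖dtft f‖ ^ 2 = (2 * Real.pi) ^ d * ∑' k, ‖f k‖ ^ 2 := by
  set χ : (Fin d → ℤ) → Lp ℂ 2 (cubeMeasure d) :=
    fun k => (memLp_character k).toLp (character k) with hχ
  have h1 : ∀ k, inner ℂ (dtft f) (χ k) = (2 * Real.pi : ℂ) ^ d * (starRingEnd ℂ) (f k) := by
    intro k
    have h2 : HasSum (fun l => inner ℂ (χ k) (f l • χ l)) (inner ℂ (χ k) (dtft f)) :=
      (hasSum_dtft f).mapL (innerSL ℂ (χ k))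
    have h3 : inner ℂ (χ k) (dtft f) = f k * (2 * Real.pi : ℂ) ^ d := by
      refine h2.unique ?_
      convert hasSum_single (f := fun l => inner ℂ (χ k) (f l • χ l)) k ?_ using 1
      · simp only [inner_smul_right, hχ, inner_character, if_true]
      · intro l hl
        simp only [inner_smul_right, hχ, inner_character, if_neg hl.symm, mul_zero]
    rw [← inner_conj_symm, h3, map_mul, map_pow, map_mul, Complex.conj_ofReal, mul_comm]
    simp [Complex.conj_ofNat]
  have h2 : HasSum (fun k => inner ℂ (dtft f) (f k • χ k)) (inner ℂ (dtft f) (dtft f)) :=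
    (hasSum_dtft f).mapL (innerSL ℂ (dtft f))
  have h3 : ∀ k, inner ℂ (dtft f) (f k • χ k) =
      (((2 * Real.pi) ^ d * ‖f k‖ ^ 2 : ℝ) : ℂ) := by
    intro k
    rw [inner_smul_right, h1, mul_left_comm, Complex.mul_conj, Complex.normSq_eq_norm_sq]
    push_cast; ring
  simp_rw [h3, inner_self_eq_norm_sq_to_K] at h2
  have h4 : HasSum (fun k => (2 * Real.pi) ^ d * ‖f k‖ ^ 2) (‖dtft f‖ ^ 2) := by
    rw [← Complex.hasSum_ofReal]
    simpa using h2
  rw [← h4.tsum_eq, tsum_mul_left]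

theorem norm_sq_eq_tsum (f : L2Lattice d) : ‖f‖ ^ 2 = ∑' k, ‖f k‖ ^ 2 := by
  have := lp.norm_rpow_eq_tsum (p := 2) (by norm_num) f
  simpa using this

theorem summable_norm_sq (f : L2Lattice d) : Summable fun k => ‖f k‖ ^ 2 := by
  simpa using (lp.memℓp f).summable (by norm_num)

/-- The Fourier transform as a bounded operator. -/
def dtftL (d : ℕ) : L2Lattice d →L[ℂ] Lp ℂ 2 (cubeMeasure d) :=
  LinearMap.mkContinuous
    { toFun := dtft
      map_add' := dtft_add
      map_smul' := dtft_smul } (Real.sqrt ((2 * Real.pi) ^ d)) fun f => by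
    refine (sq_le_sq₀ (norm_nonneg _) (by positivity)).1 ?_
    rw [mul_pow, Real.sq_sqrt (by positivity), norm_sq_eq_tsum]
    exact (norm_dtft_sq f).le

theorem dtftL_apply (f : L2Lattice d) : dtftL d f = dtft f := rfl

/-- The Parseval factor `(2π)^d ≥ 1` is dropped, so the pointwise constant `C` also serves for the
total energy. -/
theorem tsum_enorm_sq_le_lintegral (f : L2Lattice d) :
    ∑' k, ‖f k‖ₑ ^ 2 ≤ ∫⁻ θ in cube d, ‖dtft f θ‖ₑ ^ 2 := by
  have h1 : ∑' k, ‖f k‖ₑ ^ 2 = ENNReal.ofReal (∑' k, ‖f k‖ ^ 2) := by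
    rw [ENNReal.ofReal_tsum_of_nonneg (fun k => by positivity) (summable_norm_sq f)]
    refine tsum_congr fun k => ?_
    rw [ENNReal.ofReal_pow (norm_nonneg _), ofReal_norm]
  have h2 : ∫⁻ θ in cube d, ‖dtft f θ‖ₑ ^ 2 = ENNReal.ofReal (‖dtft f‖ ^ 2) := by
    rw [ENNReal.ofReal_pow (norm_nonneg _), ofReal_norm, Lp.enorm_def,
      eLpNorm_eq_lintegral_rpow_enorm_toReal (by norm_num) (by norm_num)]
    simp only [ENNReal.toReal_ofNat, ENNReal.rpow_ofNat]
    rw [← ENNReal.rpow_natCast, ← ENNReal.rpow_mul]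
    norm_num
  rw [h1, h2, norm_dtft_sq]
  refine ENNReal.ofReal_le_ofReal (le_mul_of_one_le_left (tsum_nonneg fun k => by positivity) ?_)
  exact one_le_pow₀ (by linarith [Real.pi_gt_three])

/-- Translation on the lattice. -/
def shift (e : Fin d → ℤ) (f : L2Lattice d) : L2Lattice d :=
  ⟨fun k => f (k + e), by
    refine memℓp_gen ?_
    have := (Equiv.addRight e).summable_iff.2 ((lp.memℓp f).summable (by norm_num))
    simpa [Function.comp_def] using this⟩

theorem shift_apply (e : Fin d → ℤ) (f : L2Lattice d) (k : Fin d → ℤ) :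
    shift e f k = f (k + e) := rfl

/-- Multiplying by the character of `-e` sends the character of `k + e` to that of `k`; reindexing
the series does the rest. -/
theorem dtft_shift (e : Fin d → ℤ) (f : L2Lattice d) :
    dtft (shift e f) = multiplier d (characterBCF (-e)) (dtft f) := by
  refine (hasSum_dtft (shift e f)).unique ?_
  have h1 := (hasSum_dtft f).mapL (multiplier d (characterBCF (-e)))
  simp only [map_smul, multiplier_character] at h1
  rw [← (Equiv.addRight e).hasSum_iff] at h1
  convert h1 using 2 with k
  simp only [Function.comp, Equiv.coe_addRight, shift_apply, add_neg_cancel_right]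

/-- Each second difference is a sum of shifts with symbol `e^{iθ_j} + e^{-iθ_j} - 2 = -(2
sin(θ_j/2))²`, and these sum to `-|ξ|²`. -/
theorem dtft_laplacian {c : ℝ} {f w : L2Lattice d}
    (h : ∀ k, w k - (c : ℂ) * discreteLaplacian f k = 0) :
    dtft w = -(c • multiplier d (xiSqBCF d) (dtft f)) := by
  have hw : w = (c : ℂ) • ∑ j : Fin d,
      (shift (Pi.single j 1) f + shift (-Pi.single j 1) f + (-2 : ℂ) • f) := by
    refine lp.ext (funext fun k => ?_)
    rw [sub_eq_zero.1 (h k), lp.coeFn_smul, Pi.smul_apply, lp.coeFn_sum, Finset.sum_apply,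
      smul_eq_mul]
    congr 1
    refine Finset.sum_congr rfl fun j _ => ?_
    rw [lp.coeFn_add, lp.coeFn_add, lp.coeFn_smul]
    simp only [Pi.add_apply, Pi.smul_apply, shift_apply, fwdDiff, bwdDiff, smul_eq_mul,
      add_sub_cancel_right]
    rw [← sub_eq_add_neg]
    ring
  have hM : ∑ j : Fin d, (characterBCF (-Pi.single j 1) + characterBCF (Pi.single j 1) +
      (-2 : ℂ) • 1) = -xiSqBCF d := by
    ext θ
    rw [BoundedContinuousFunction.coe_neg, Pi.neg_apply, xiSqBCF_apply, norm_xi_sq,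
      BoundedContinuousFunction.coe_sum, Finset.sum_apply, Complex.ofReal_sum,
      ← Finset.sum_neg_distrib]
    refine Finset.sum_congr rfl fun j _ => ?_
    rw [← character_single_add]
    simp [characterBCF_apply, sub_eq_add_neg]
  rw [← dtftL_apply, hw, map_smul, map_sum]
  simp only [map_add, map_smul, dtftL_apply, dtft_shift, neg_neg]
  have h2 : ∀ j : Fin d, multiplier d (characterBCF (-Pi.single j 1)) (dtft f) +
      multiplier d (characterBCF (Pi.single j 1)) (dtft f) + (-2 : ℂ) • dtft f =
      multiplier d (characterBCF (-Pi.single j 1) + characterBCF (Pi.single j 1) +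
        (-2 : ℂ) • 1) (dtft f) := by
    intro j
    simp only [map_add, map_smul, _root_.add_apply, _root_.smul_apply,
      multiplier_one]
  simp_rw [h2]
  rw [← _root_.sum_apply, ← map_sum, hM, map_neg, _root_.neg_apply,
    smul_neg]
  rfl

theorem dtft_fwdDiff (j : Fin d) (f : L2Lattice d) :
    dtft (shift (Pi.single j 1) f - f) =ᵐ[cubeMeasure d]
      fun θ => (character (-Pi.single j 1) θ - 1) * dtft f θ := by
  have h : dtft (shift (Pi.single j 1) f - f) =
      multiplier d (characterBCF (-Pi.single j 1) - 1) (dtft f) := by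
    rw [← dtftL_apply, map_sub, dtftL_apply, dtftL_apply, dtft_shift, map_sub,
      _root_.sub_apply, multiplier_one]
  rw [h]
  filter_upwards [coeFn_multiplier (characterBCF (-Pi.single j 1) - 1) (dtft f)] with θ hθ
  rw [hθ]
  simp [characterBCF_apply]

/-- The total energy is controlled by the integral of the energy density. -/
theorem totalEnergy_le_lintegral (a : ℝ → ℝ) (u v : ℝ → L2Lattice d) (t : ℝ) :
    totalEnergy a u v t ≤
      ∫⁻ θ in cube d, ENNReal.ofReal (energyDensity (a t) (dtft (u t)) (dtft (v t)) θ) := by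
  have h1 : ∀ θ, ENNReal.ofReal (energyDensity (a t) (dtft (u t)) (dtft (v t)) θ) =
      ‖dtft (v t) θ‖ₑ ^ 2 + ENNReal.ofReal (a t ^ 2) *
        ∑ j : Fin d, ENNReal.ofReal ((2 * Real.sin (θ j / 2)) ^ 2) * ‖dtft (u t) θ‖ₑ ^ 2 := by
    intro θ
    unfold energyDensity
    rw [ENNReal.ofReal_add (by positivity) (by positivity), mul_assoc,
      ENNReal.ofReal_mul (by positivity), ENNReal.ofReal_mul (by positivity), norm_xi_sq,
      ENNReal.ofReal_sum_of_nonneg (fun j _ => by positivity), Finset.sum_mul,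
      ENNReal.ofReal_pow (norm_nonneg _), ENNReal.ofReal_pow (norm_nonneg _), ofReal_norm,
      ofReal_norm]
  have hm : ∀ f : L2Lattice d, Measurable fun θ => ‖dtft f θ‖ₑ ^ 2 := fun f =>
    ((Lp.stronglyMeasurable (dtft f)).measurable.enorm).pow_const 2
  have hms : ∀ j : Fin d, Measurable fun θ : Fin d → ℝ =>
      ENNReal.ofReal ((2 * Real.sin (θ j / 2)) ^ 2) * ‖dtft (u t) θ‖ₑ ^ 2 := fun j =>
    (by fun_prop : Measurable fun θ : Fin d → ℝ =>
      ENNReal.ofReal ((2 * Real.sin (θ j / 2)) ^ 2)).mul (hm _)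
  simp_rw [h1]
  rw [lintegral_add_left (hm _), lintegral_const_mul _ (Finset.measurable_sum _ fun j _ => hms j),
    lintegral_finsetSum _ fun j _ => hms j]
  unfold totalEnergy
  gcongr with j
  · exact tsum_enorm_sq_le_lintegral (v t)
  · refine (tsum_enorm_sq_le_lintegral (shift (Pi.single j 1) (u t) - u t)).trans
      (lintegral_congr_ae ?_).le
    filter_upwards [dtft_fwdDiff j (u t)] with θ hθ
    rw [hθ, enorm_mul, mul_pow, ← norm_character_single_sub_one, ENNReal.ofReal_pow (norm_nonneg _),
      ofReal_norm]

/-! ### Lattice solutions in frequency space -/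

/-- The Fourier transform of a lattice solution agrees almost everywhere, at each time, with a
pointwise solution in frequency space. -/
theorem IsSolution.exists_isFrequencySolution {a : ℝ → ℝ} {a₁ : ℝ} {u₀ u₁ : L2Lattice d}
    {u v : ℝ → L2Lattice d} (h : IsSolution a u₀ u₁ u v) (ha : ∀ t : ℝ, 0 ≤ t → |a t| ≤ a₁)
    (hac : ContinuousOn a (Ici 0)) :
    ∃ w z : ℝ → (Fin d → ℝ) → ℂ, IsFrequencySolution a w z ∧
      w 0 = dtft u₀ ∧ z 0 = dtft u₁ ∧ ∀ t : ℝ, 0 ≤ t →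
        dtft (u t) =ᵐ[cubeMeasure d] w t ∧ dtft (v t) =ᵐ[cubeMeasure d] z t := by
  set T : ((Fin d → ℝ) →ᵇ ℂ) →L[ℝ] ((Fin d → ℝ) →ᵇ ℂ) :=
    ContinuousLinearMap.mul ℝ _ (xiSqBCF d) with hT
  -- Fundamental solutions with data `(1, 0)` and `(0, 1)`, built in the bounded continuous
  -- functions, where multiplication by `|ξ|²` is a bounded operator. They make sense at every `θ`
  -- and also act on `L²` as multipliers.
  obtain ⟨Y₁, Z₁, hY₁, hZ₁, h₁⟩ := exists_oscillator_solution ha hac T 1 0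
  obtain ⟨Y₂, Z₂, hY₂, hZ₂, h₂⟩ := exists_oscillator_solution ha hac T 0 1
  set f₀ := dtft u₀ with hf_init
  set f₁ := dtft u₁ with hf_deriv
  refine ⟨fun t θ => Y₁ t θ * f₀ θ + Y₂ t θ * f₁ θ, fun t θ => Z₁ t θ * f₀ θ + Z₂ t θ * f₁ θ,
    ⟨fun θ _ t ht => ?_, fun θ _ t ht => ?_⟩, ?_, ?_, ?_⟩
  · have ev := fun {X : ℝ → (Fin d → ℝ) →ᵇ ℂ} {X' : (Fin d → ℝ) →ᵇ ℂ}
        (hX : HasDerivWithinAt X X' (Ici 0) t) =>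
      (BoundedContinuousFunction.evalCLM ℝ θ).hasFDerivAt.comp_hasDerivWithinAt t hX
    exact ((ev (h₁ t ht).1).mul_const (f₀ θ)).add ((ev (h₂ t ht).1).mul_const (f₁ θ))
  · have ev := fun {X : ℝ → (Fin d → ℝ) →ᵇ ℂ} {X' : (Fin d → ℝ) →ᵇ ℂ}
        (hX : HasDerivWithinAt X X' (Ici 0) t) =>
      (BoundedContinuousFunction.evalCLM ℝ θ).hasFDerivAt.comp_hasDerivWithinAt t hX
    refine (((ev (h₁ t ht).2).mul_const (f₀ θ)).add
      ((ev (h₂ t ht).2).mul_const (f₁ θ))).congr_deriv ?_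
    simp [hT, xiSqBCF_apply]
    ring
  · ext θ; simp [hY₁, hY₂]
  · ext θ; simp [hZ₁, hZ₂]
  · intro t ht
    set S : Lp ℂ 2 (cubeMeasure d) →L[ℝ] Lp ℂ 2 (cubeMeasure d) :=
      (multiplier d (xiSqBCF d)).restrictScalars ℝ with hS
    have hu : ∀ t : ℝ, 0 ≤ t → HasDerivWithinAt (fun s => dtft (u s)) (dtft (v t)) (Ici 0) t ∧
        HasDerivWithinAt (fun s => dtft (v s)) (-(a t ^ 2 • S (dtft (u t)))) (Ici 0) t := by
      intro t ht
      have ev := fun {X : ℝ → L2Lattice d} {X' : L2Lattice d}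
        (hX : HasDerivWithinAt X X' (Ici 0) t) =>
        ((dtftL d).restrictScalars ℝ).hasFDerivAt.comp_hasDerivWithinAt t hX
      obtain ⟨w, hw, he⟩ := h.equation t ht
      refine ⟨ev (h.hasDeriv t ht), (ev hw).congr_deriv ?_⟩
      exact dtft_laplacian he
    -- `multiplier` is bounded and linear in the multiplying function, so sup-norm derivatives pass
    -- to derivatives in `L²`.
    have act : ∀ {X : ℝ → (Fin d → ℝ) →ᵇ ℂ} {X' : (Fin d → ℝ) →ᵇ ℂ} {t : ℝ}
        (f : Lp ℂ 2 (cubeMeasure d)),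
        HasDerivWithinAt X X' (Ici 0) t →
        HasDerivWithinAt (fun s => multiplier d (X s) f) (multiplier d X' f) (Ici 0) t :=
      fun f hX => (((multiplier d).flip f).restrictScalars ℝ).hasFDerivAt.comp_hasDerivWithinAt _ hX
    have hW : ∀ t : ℝ, 0 ≤ t →
        HasDerivWithinAt (fun s => multiplier d (Y₁ s) f₀ + multiplier d (Y₂ s) f₁)
          (multiplier d (Z₁ t) f₀ + multiplier d (Z₂ t) f₁) (Ici 0) t ∧
        HasDerivWithinAt (fun s => multiplier d (Z₁ s) f₀ + multiplier d (Z₂ s) f₁)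
          (-(a t ^ 2 • S (multiplier d (Y₁ t) f₀ + multiplier d (Y₂ t) f₁))) (Ici 0) t := by
      intro t ht
      refine ⟨(act f₀ (h₁ t ht).1).add (act f₁ (h₂ t ht).1),
        ((act f₀ (h₁ t ht).2).add (act f₁ (h₂ t ht).2)).congr_deriv ?_⟩
      have e : ∀ (y : (Fin d → ℝ) →ᵇ ℂ) (f : Lp ℂ 2 (cubeMeasure d)),
          multiplier d (-(a t ^ 2 • T y)) f = -(a t ^ 2 • S (multiplier d y f)) := by
        intro y f
        have e1 : -(a t ^ 2 • T y) = (-((a t ^ 2 : ℝ) : ℂ)) • (xiSqBCF d * y) := by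
          ext θ; simp [hT]
        rw [e1, map_smul, _root_.smul_apply, multiplier_mul, neg_smul]
        rfl
      rw [e, e, map_add, smul_add, neg_add]
    -- `û` and the superposition of fundamental solutions solve the same linear equation in `L²`
    -- with the same data.
    obtain ⟨e1, e2⟩ := oscillator_solution_unique ha S hu hW
      (by simp [hY₁, hY₂, multiplier_one, h.init, hf_init])
      (by simp [hZ₁, hZ₂, multiplier_one, h.init_deriv, hf_deriv]) ht
    constructor
    · rw [e1]
      filter_upwards [Lp.coeFn_add (multiplier d (Y₁ t) f₀) (multiplier d (Y₂ t) f₁),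
        coeFn_multiplier (Y₁ t) f₀, coeFn_multiplier (Y₂ t) f₁] with θ g1 g2 g3
      rw [g1, Pi.add_apply, g2, g3]
    · rw [e2]
      filter_upwards [Lp.coeFn_add (multiplier d (Z₁ t) f₀) (multiplier d (Z₂ t) f₁),
        coeFn_multiplier (Z₁ t) f₀, coeFn_multiplier (Z₂ t) f₁] with θ g1 g2 g3
      rw [g1, Pi.add_apply, g2, g3]

/-! ### From oscillators to energy densities -/

theorem norm_xi_le {d : ℕ} (θ : Fin d → ℝ) : ‖xi θ‖ ≤ Real.sqrt (4 * d) :=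
  Real.le_sqrt_of_sq_le (norm_xi_sq_le θ)

/-- An energy estimate for real oscillations yields one for solutions in frequency space. -/
theorem IsFrequencySolution.energyDensity_le {d : ℕ} {a Θ Λ : ℝ → ℝ} {N C R : ℝ} (hC : 1 ≤ C)
    (hR : ∀ θ : Fin d → ℝ, ‖xi θ‖ ≤ R)
    (H : ∀ (r : ℝ) (x y : ℝ → ℝ), 0 < r → r ≤ R → IsOscillation (fun t => a t * r) x y →
        ∀ t : ℝ, 0 ≤ t → y t ^ 2 + (a t * r) ^ 2 * x t ^ 2 ≤
          C * Real.exp (2 * r * Θ (rateInv Λ (N / r))) * (y 0 ^ 2 + (a 0 * r) ^ 2 * x 0 ^ 2))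
    {w z : ℝ → (Fin d → ℝ) → ℂ} (h : IsFrequencySolution a w z) {t : ℝ} (ht : 0 ≤ t)
    {θ : Fin d → ℝ} (hθ : θ ∈ cube d) :
    energyDensity (a t) (w t) (z t) θ ≤
      C * weight Θ Λ N θ * energyDensity (a 0) (w 0) (z 0) θ := by
  unfold energyDensity weight
  -- At `ξ(θ) = 0` the energy is `|z|²`, and `z` is constant.
  rcases (norm_nonneg (xi θ)).eq_or_lt with h0 | h0
  · have hz : z t θ = z 0 θ := by
      refine constant_of_has_deriv_right_zero (f := fun s => z s θ) (a := 0) (b := t) ?_ ?_ t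
        (right_mem_Icc.2 ht)
      · exact fun s hs =>
          (h.equation θ hθ s hs.1).continuousWithinAt.mono Icc_subset_Ici_self
      · intro s hs
        have := (h.equation θ hθ s hs.1).mono (Ici_subset_Ici.2 hs.1)
        simpa [← h0] using this
    rw [hz, ← h0]
    simp only [mul_zero, zero_mul, Real.exp_zero, mul_one, ne_eq, OfNat.ofNat_ne_zero,
      not_false_eq_true, zero_pow, add_zero]
    exact le_mul_of_one_le_left (by positivity) hC
  · have hre : IsOscillation (fun t => a t * ‖xi θ‖) (fun s => (w s θ).re) fun s => (z s θ).re :=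
      ⟨fun s hs => Complex.reCLM.hasFDerivAt.comp_hasDerivWithinAt s (h.hasDeriv θ hθ s hs),
        fun s hs => (Complex.reCLM.hasFDerivAt.comp_hasDerivWithinAt s
          (h.equation θ hθ s hs)).congr_deriv (by
            rw [Complex.reCLM_apply, ← Complex.ofReal_neg, Complex.re_ofReal_mul]; ring)⟩
    have him : IsOscillation (fun t => a t * ‖xi θ‖) (fun s => (w s θ).im) fun s => (z s θ).im :=
      ⟨fun s hs => Complex.imCLM.hasFDerivAt.comp_hasDerivWithinAt s (h.hasDeriv θ hθ s hs),
        fun s hs => (Complex.imCLM.hasFDerivAt.comp_hasDerivWithinAt s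
          (h.equation θ hθ s hs)).congr_deriv (by
            rw [Complex.imCLM_apply, ← Complex.ofReal_neg, Complex.im_ofReal_mul]; ring)⟩
    have h1 := H _ _ _ h0 (hR θ) hre t ht
    have h2 := H _ _ _ h0 (hR θ) him t ht
    have e : ∀ s, ‖z s θ‖ ^ 2 + a s ^ 2 * ‖xi θ‖ ^ 2 * ‖w s θ‖ ^ 2 =
        ((z s θ).re ^ 2 + (a s * ‖xi θ‖) ^ 2 * (w s θ).re ^ 2) +
          ((z s θ).im ^ 2 + (a s * ‖xi θ‖) ^ 2 * (w s θ).im ^ 2) := by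
      intro s
      rw [Complex.sq_norm, Complex.sq_norm, Complex.normSq_apply, Complex.normSq_apply]
      ring
    rw [e, e, mul_add]
    exact add_le_add h1 h2

end SemiDiscreteWave

end

/-! ### The main theorem -/

theorem theorem3p2 (d m : ℕ) (hm : 2 ≤ m) (a Θ Ξ Λ : ℝ → ℝ) (a₀ a₁ : ℝ) (ha₀ : 0 < a₀)
    (ha : ∀ t : ℝ, 0 ≤ t → a₀ ≤ a t ∧ a t ≤ a₁)
    (hΘ_pos : ∀ t : ℝ, 0 ≤ t → 0 < Θ t) (hΘ_mono : MonotoneOn Θ (Set.Ici 0))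
    (hΞ_pos : ∀ t : ℝ, 0 ≤ t → 0 < Ξ t) (hΞ_mono : MonotoneOn Ξ (Set.Ici 0))
    (hΛ_pos : ∀ t : ℝ, 0 ≤ t → 0 < Λ t) (hΛ_mono : StrictMonoOn Λ (Set.Ici 0))
    (hΛ_cont : ContinuousOn Λ (Set.Ici 0))
    (hΛ_lim : Filter.Tendsto Λ Filter.atTop Filter.atTop)
    (h_stab : SemiDiscreteWave.StabilizationBound a Θ)
    (h_deriv : SemiDiscreteWave.DerivativeBounds m a Ξ)
    (h_ratio : SemiDiscreteWave.RatioIncreasesToInfinity Θ Λ)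
    (h_dom : SemiDiscreteWave.DominatedBy Λ Ξ)
    (h_tail : SemiDiscreteWave.TailBound m Θ Ξ Λ) :
    ∃ N₀ : ℝ, 0 < N₀ ∧ (∀ θ ∈ SemiDiscreteWave.cube d, Λ 0 * ‖SemiDiscreteWave.xi θ‖ ≤ N₀) ∧
    ∃ C : ℝ, 0 < C ∧
      -- pointwise estimate of the energy density, for every solution in frequency space
      (∀ w z : ℝ → (Fin d → ℝ) → ℂ, SemiDiscreteWave.IsFrequencySolution a w z →
        ∀ t : ℝ, 0 ≤ t → ∀ θ ∈ SemiDiscreteWave.cube d,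
          SemiDiscreteWave.energyDensity (a t) (w t) (z t) θ ≤
            C * SemiDiscreteWave.weight Θ Λ N₀ θ *
              SemiDiscreteWave.energyDensity (a 0) (w 0) (z 0) θ) ∧
      -- the same for the Fourier transform of every solution on the lattice
      (∀ (u₀ u₁ : SemiDiscreteWave.L2Lattice d) (u v : ℝ → SemiDiscreteWave.L2Lattice d),
        SemiDiscreteWave.IsSolution a u₀ u₁ u v →
        ∀ t : ℝ, 0 ≤ t → ∀ᵐ θ ∂(SemiDiscreteWave.cubeMeasure d),
          SemiDiscreteWave.energyDensity (a t) (SemiDiscreteWave.dtft (u t))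
              (SemiDiscreteWave.dtft (v t)) θ ≤
            C * SemiDiscreteWave.weight Θ Λ N₀ θ *
              SemiDiscreteWave.energyDensity (a 0) (SemiDiscreteWave.dtft u₀)
                (SemiDiscreteWave.dtft u₁) θ) ∧
      -- finiteness of the weighted initial energy for all `N`
      (∀ (u₀ u₁ : SemiDiscreteWave.L2Lattice d) (u v : ℝ → SemiDiscreteWave.L2Lattice d),
        SemiDiscreteWave.IsSolution a u₀ u₁ u v →
        (∀ N : ℝ, 1 ≤ N → SemiDiscreteWave.weightedEnergy a Θ Λ N u₀ u₁ < ⊤) →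
        ∃ N₁ : ℝ, N₀ ≤ N₁ ∧ SemiDiscreteWave.weightedEnergy a Θ Λ N₁ u₀ u₁ < ⊤ ∧
          ∀ t : ℝ, 0 ≤ t → SemiDiscreteWave.totalEnergy a u v t ≤
            ENNReal.ofReal C * SemiDiscreteWave.weightedEnergy a Θ Λ N₁ u₀ u₁) ∧
      -- finiteness of the weighted initial energy for the fixed `N₀`
      (∀ (u₀ u₁ : SemiDiscreteWave.L2Lattice d) (u v : ℝ → SemiDiscreteWave.L2Lattice d),
        SemiDiscreteWave.IsSolution a u₀ u₁ u v →
        SemiDiscreteWave.weightedEnergy a Θ Λ N₀ u₀ u₁ < ⊤ →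
        ∀ t : ℝ, 0 ≤ t → SemiDiscreteWave.totalEnergy a u v t ≤
          ENNReal.ofReal C * SemiDiscreteWave.weightedEnergy a Θ Λ N₀ u₀ u₁) := by
  obtain ⟨N, C, hN0, hNR, hN1, hC, H⟩ := SemiDiscreteWave.exists_energy_le hm ha₀ ha hΘ_pos hΘ_mono
    hΞ_pos hΛ_pos hΛ_mono hΛ_cont hΛ_lim h_stab h_deriv h_ratio.1 h_dom h_tail
    (Real.sqrt (4 * d))
  have hΛ0 := hΛ_pos 0 le_rfl
  have hC0 : 0 < C := by linarith
  have hfreq : ∀ w z : ℝ → (Fin d → ℝ) → ℂ, SemiDiscreteWave.IsFrequencySolution a w z →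
      ∀ t : ℝ, 0 ≤ t → ∀ θ ∈ SemiDiscreteWave.cube d,
        SemiDiscreteWave.energyDensity (a t) (w t) (z t) θ ≤
          C * SemiDiscreteWave.weight Θ Λ N θ *
            SemiDiscreteWave.energyDensity (a 0) (w 0) (z 0) θ := fun w z h t ht θ hθ =>
    h.energyDensity_le hC SemiDiscreteWave.norm_xi_le H ht hθ
  have hae : ∀ (u₀ u₁ : SemiDiscreteWave.L2Lattice d) (u v : ℝ → SemiDiscreteWave.L2Lattice d),
      SemiDiscreteWave.IsSolution a u₀ u₁ u v →
      ∀ t : ℝ, 0 ≤ t → ∀ᵐ θ ∂(SemiDiscreteWave.cubeMeasure d),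
        SemiDiscreteWave.energyDensity (a t) (SemiDiscreteWave.dtft (u t))
            (SemiDiscreteWave.dtft (v t)) θ ≤
          C * SemiDiscreteWave.weight Θ Λ N θ *
            SemiDiscreteWave.energyDensity (a 0) (SemiDiscreteWave.dtft u₀)
              (SemiDiscreteWave.dtft u₁) θ := by
    intro u₀ u₁ u v h t ht
    obtain ⟨w, z, hwz, hw0, hz0, hwz_ae⟩ := h.exists_isFrequencySolution (a₁ := a₁)
      (fun s hs => abs_le.2 ⟨by linarith [ha s hs], (ha s hs).2⟩) h_deriv.1.continuousOn
    have hcube : ∀ᵐ θ ∂(SemiDiscreteWave.cubeMeasure d), θ ∈ SemiDiscreteWave.cube d :=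
      ae_restrict_mem (MeasurableSet.univ_pi fun _ => measurableSet_Icc)
    filter_upwards [(hwz_ae t ht).1, (hwz_ae t ht).2, hcube] with θ h1 h2 hθ
    have h3 := hfreq w z hwz t ht θ hθ
    rw [hw0, hz0] at h3
    unfold SemiDiscreteWave.energyDensity at h3 ⊢
    rw [h1, h2]
    exact h3
  have htot : ∀ (u₀ u₁ : SemiDiscreteWave.L2Lattice d)
      (u v : ℝ → SemiDiscreteWave.L2Lattice d), SemiDiscreteWave.IsSolution a u₀ u₁ u v →
      ∀ t : ℝ, 0 ≤ t → SemiDiscreteWave.totalEnergy a u v t ≤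
        ENNReal.ofReal C * SemiDiscreteWave.weightedEnergy a Θ Λ N u₀ u₁ := by
    intro u₀ u₁ u v h t ht
    refine (SemiDiscreteWave.totalEnergy_le_lintegral a u v t).trans ?_
    unfold SemiDiscreteWave.weightedEnergy
    rw [← lintegral_const_mul' _ _ ENNReal.ofReal_ne_top]
    refine lintegral_mono_ae ?_
    filter_upwards [hae u₀ u₁ u v h t ht] with θ hθ
    rw [← ENNReal.ofReal_mul hC0.le, ← mul_assoc]
    exact ENNReal.ofReal_le_ofReal hθ
  refine ⟨N, hN0, fun θ _ => le_trans ?_ hNR, C, hC0, hfreq, hae, ?_, ?_⟩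
  · gcongr
    exact SemiDiscreteWave.norm_xi_le θ
  -- `N₁ = N₀` is admissible because `N₀` was chosen at least `1`.
  · exact fun u₀ u₁ u v h hfin => ⟨N, le_rfl, hfin N hN1, htot u₀ u₁ u v h⟩
  · exact fun u₀ u₁ u v h _ => htot u₀ u₁ u v h
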